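/- Let $\mathcal H$ be the upper half-plane and $q=e^{2\pi i z}$. Let $\Gamma\subseteq \mathrm{SL}_2(\mathbb Z)$ be a subgroup. A holomorphic function $F:\mathcal H\to\mathbb C$ is a quasimodular form of weight $w$, depth (at most) $s$ and level $\Gamma$ if there are holomorphic functions $F_0,\dots,F_s:\mathcal H\to\mathbb C$ such that $$(cz+d)^{-w}F\Big(\frac{az+b}{cz+d}\Big)=\sum_{r=0}^{s}F_r(z)\Big(\frac{c}{cz+d}\Big)^r\qquad\text{for all } z\in\mathcal H,\ \begin{pmatrix}a&b\\c&d\end{pmatrix}\in\Gamma,$$ and which are holomorphic at the cusps, i.e. for every $0\le r\le s$ and every $\begin{pmatrix}a&b\\c&d\end{pmatrix}\in\mathrm{SL}_2(\mathbb Z)$ the function $z\mapsto (cz+d)^{-(w-2r)}F_r\big(\frac{az+b}{cz+d}\big)$ is bounded as $\mathrm{Im}\,z\to\infty$. It is completely positive if it has a Fourier expansion $F=\sum_{n\ge0}a_nq^n$ with all $a_n$ real and nonnegative. A normalized extremal quasimodular form of weight $w$ and depth $s$ is a nonzero quasimodular form of weight $w$, depth $s$ and level $\mathrm{SL}_2(\mathbb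 Z)$ whose vanishing order at $i\infty$ (the least $n$ with $a_n\neq0$) is the highest among all nonzero quasimodular forms of weight $w$, depth $s$ and level $\mathrm{SL}_2(\mathbb Z)$, and whose first nonzero Fourier coefficient is $1$. **Proposition.** For each $w\in\{4,8,10,12\}$ there is exactly one normalized extremal quasimodular form $X_{w,2}$ of weight $w$ and depth $2$, and $$Y_{w,2}(z):=X_{w,2}(z)-2^{w-2}X_{w,2}(2z)$$ is a completely positive quasimodular form of weight $w$, depth $2$ and level $\Gamma_0(2)$; that is, all Fourier coefficients of $Y_{4,2}$, $Y_{8,2}$, $Y_{10,2}$ and $Y_{12,2}$ are real and nonnegative. -/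

import Mathlib

open UpperHalfPlane
open scoped MatrixGroups ModularForm Manifold CongruenceSubgroup

noncomputable section

/-- `F : ℍ → ℂ` is a quasimodular form of weight `w`, depth at most `s` and level `Γ ≤ SL(2, ℤ)`:
it is holomorphic, and there are holomorphic functions `G 0, …, G s` with
`(c z + d) ^ (-w) * F (γ z) = ∑ r, G r z * (c / (c z + d)) ^ r` for all `γ = (a b; c d) ∈ Γ`.
Holomorphy at the cusps: each component `G r`, which has weight `w - 2 r`, is bounded
at `i∞` after slashing with an arbitrary element of `SL(2, ℤ)`. -/
def IsQuasimodularForm (w : ℤ) (s : ℕ) (Γ : Subgroup SL(2, ℤ)) (F : ℍ → ℂ) : Prop :=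
  MDiff F ∧
  ∃ G : Fin (s + 1) → ℍ → ℂ,
    (∀ r, MDiff (G r)) ∧
    (∀ r : Fin (s + 1), ∀ γ : SL(2, ℤ), IsBoundedAtImInfty (G r ∣[w - 2 * ((r : ℕ) : ℤ)] γ)) ∧
    ∀ γ ∈ Γ, ∀ z : ℍ,
      (F ∣[w] γ) z = ∑ r : Fin (s + 1), G r z * (((γ 1 0 : ℤ) : ℂ) / denom γ z) ^ (r : ℕ)

/-- A quasimodular form is completely positive if its Fourier coefficients (with respect to
`q = exp (2 π i z)`) are all real and nonnegative. -/
def IsCompletelyPositive (w : ℤ) (s : ℕ) (Γ : Subgroup SL(2, ℤ)) (F : ℍ → ℂ) : Prop :=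
  IsQuasimodularForm w s Γ F ∧
  ∃ a : ℕ → ℝ, (∀ n, 0 ≤ a n) ∧
    ∀ z : ℍ, HasSum (fun n : ℕ => (a n : ℂ) * Function.Periodic.qParam 1 z ^ n) (F z)

/-- Vanishing order at `i∞` of a function with a Fourier expansion in `q = exp (2 π i z)`. -/
def vanishingOrder (F : ℍ → ℂ) : ℕ∞ := (qExpansion 1 F).order

/-- `F` is a normalized extremal quasimodular form of level one, weight `w` and depth `s`: it is
nonzero, has the highest vanishing order at `i∞` among all nonzero quasimodular forms of that
weight and depth, and its first nonzero Fourier coefficient is `1`. -/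
def IsNormalizedExtremal (w : ℤ) (s : ℕ) (F : ℍ → ℂ) : Prop :=
  IsQuasimodularForm w s ⊤ F ∧ F ≠ 0 ∧
  (∀ G : ℍ → ℂ, IsQuasimodularForm w s ⊤ G → G ≠ 0 → vanishingOrder G ≤ vanishingOrder F) ∧
  (qExpansion 1 F).coeff (vanishingOrder F).toNat = 1

/-- The point `2 z` of the upper half-plane. -/
def doublePoint (z : ℍ) : ℍ :=
  ⟨2 * (z : ℂ), by simpa using z.im_pos⟩

/-- For `X = X_{w,s}`, the function `Y_{w,s} (z) = X (z) - 2 ^ (w - s) * X (2 z)`. -/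
def extremalY (w : ℤ) (s : ℕ) (X : ℍ → ℂ) : ℍ → ℂ :=
  fun z => X z - (2 : ℂ) ^ (w - (s : ℤ)) * X (doublePoint z)

end

/-!
Write `D = (2 π i)⁻¹ d/dz = q d/dq`.

A quasimodular form of level one and depth at most two is a polynomial of degree at most two in `E2`
with modular coefficients (`IsQuasimodularForm.exists_modularForm`): at a fixed point `z` the
functional equation is an identity between quadratic polynomials in `c / (c z + d)`, so the
transformation laws of the components can be read off. As modular forms of weight at most `10` are
multiples of `1`, `E₄`, `E₆`, `E₄²`, `E₄ E₆`, and those of weight `12` are spanned by `E₄³` and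
`E₆²`, the quasimodular forms of weight `4`, `8`, `10`, `12` form spaces of dimension `2`, `3`, `3`,
`4`. The first `2`, `3`, `3`, `4` Fourier coefficients are linearly independent functionals there,
which gives existence and uniqueness of the extremal form, of order `m = 1`, `2`, `2`, `3`
(`isNormalizedExtremal_and_unique` and the lemmas `IsQuasimodularForm.eq_smul_extremalFour` to
`IsQuasimodularForm.eq_smul_extremalTwelve`).

Ramanujan's identities rewrite the extremal forms through derivatives of Eisenstein series, whence
their Fourier coefficients are, with `σₖ` the divisor sums and `τ` the coefficients of `Δ`,

* `n σ₁`, `(n σ₅ - n² σ₃) / 30` and `(n σ₇ - n² σ₅) / 126` in weights `4`, `8`, `10`,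
* `(18 n σ₉ - 35 n² σ₇ + 17 τ) / 378000` in weight `12`.

The form `Y` is quasimodular of level `Γ₀(2)` because `(2 0; 0 1)` conjugates `Γ₀(2)` into
`SL(2, ℤ)` (`isQuasimodularForm_extremalY`). Its coefficients are `a n` for odd `n` and
`a (2 k) - 2 ^ (w - 2) a k` for `n = 2 k`. In weights below `12` these are nonnegative by the
elementary inequalities `n σₖ(n) ≤ σₖ₊₂(n)` and `2ᵏ σₖ(N) ≤ σₖ(2 N) ≤ (2ᵏ + 1) σₖ(N)`.

In weight `12` one needs two bounds for `τ`, obtained from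
`τ(n) = n² σ₇(n) - 540 ∑ (i σ₃(i)) (j σ₃(j))`, the sum being over `i + j = n`. The bound
`i j ≤ n² / 4` and the convolution identity for `E₄² = E₈` give `τ(n) ≥ -n² σ₇(n) / 8`
(`neg_le_tauCoeff`). In the other direction, `σ₃(i) ≥ i³` and the power mean inequality give a
lower bound of order `n⁹` for the sum (`tauCoeff_succ_le`). No deep estimate for `τ` is required.
-/

/-! ### Holomorphic functions with a `q`-expansion -/

/-- `f` is holomorphic on `ℍ` and is the sum of the power series `p` in `q = exp (2 π i z)`. -/
structure HasQExpansion (f : ℍ → ℂ) (p : PowerSeries ℂ) : Prop where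
  mdiff : MDiff f
  hasSum : ∀ z : ℍ, HasSum (fun n : ℕ => p.coeff n * Function.Periodic.qParam 1 z ^ n) (f z)

namespace HasQExpansion

variable {f g : ℍ → ℂ} {p r : PowerSeries ℂ}

lemma periodic (hf : HasQExpansion f p) : Function.Periodic (f ∘ ofComplex) (1 : ℝ) := by
  intro w
  by_cases hw : 0 < w.im
  · have hw' : 0 < (w + (1 : ℝ)).im := by simpa using hw
    simp only [Function.comp_apply]
    have h1 := hf.hasSum (ofComplex (w + (1 : ℝ)))
    have h2 := hf.hasSum (ofComplex w)
    rw [ofComplex_apply_of_im_pos hw] at h2 ⊢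
    rw [ofComplex_apply_of_im_pos hw'] at h1 ⊢
    refine h1.unique ?_
    simpa [Function.Periodic.qParam, mul_add, Complex.exp_add] using h2
  · have hw' : ¬ 0 < (w + (1 : ℝ)).im := by simpa using hw
    simp only [Function.comp_apply]
    rw [ofComplex_apply_of_im_nonpos (not_lt.mp hw), ofComplex_apply_of_im_nonpos (not_lt.mp hw')]

lemma isBoundedAtImInfty (hf : HasQExpansion f p) : IsBoundedAtImInfty f :=
  isBoundedAtImInfty_of_hasSum_qExpansion one_pos (c := fun n => p.coeff n)
    fun z => by simpa using hf.hasSum z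

lemma qExpansion_eq (hf : HasQExpansion f p) : qExpansion 1 f = p := by
  have han := analyticAt_cuspFunction_zero one_pos hf.periodic hf.mdiff hf.isBoundedAtImInfty
  have h1 := hasFPowerSeriesOnBall_cuspFunction one_pos (c := fun n => p.coeff n) han
    fun z => by simpa using hf.hasSum z
  have h2 := hasFPowerSeriesOnBall_cuspFunction one_pos (c := fun n => (qExpansion 1 f).coeff n)
    han fun z => hasSum_qExpansion one_pos hf.periodic hf.mdiff hf.isBoundedAtImInfty z
  have h := h2.hasFPowerSeriesAt.eq_formalMultilinearSeries h1.hasFPowerSeriesAt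
  ext n
  simpa using congr_arg (FormalMultilinearSeries.coeff · n) h

lemma add (hf : HasQExpansion f p) (hg : HasQExpansion g r) : HasQExpansion (f + g) (p + r) where
  mdiff := hf.mdiff.add hg.mdiff
  hasSum z := by simpa [add_mul] using (hf.hasSum z).add (hg.hasSum z)

lemma sub (hf : HasQExpansion f p) (hg : HasQExpansion g r) : HasQExpansion (f - g) (p - r) where
  mdiff := hf.mdiff.sub hg.mdiff
  hasSum z := by simpa [sub_mul] using (hf.hasSum z).sub (hg.hasSum z)

lemma smul (c : ℂ) (hf : HasQExpansion f p) : HasQExpansion (c • f) (c • p) where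
  mdiff := hf.mdiff.const_smul c
  hasSum z := by simpa [mul_assoc] using (hf.hasSum z).mul_left c

lemma mul (hf : HasQExpansion f p) (hg : HasQExpansion g r) : HasQExpansion (f * g) (p * r) where
  mdiff := hf.mdiff.mul hg.mdiff
  hasSum z := by
    have h1 := (hf.hasSum z).summable.norm
    have h2 := (hg.hasSum z).summable.norm
    have h := tsum_mul_tsum_eq_tsum_sum_antidiagonal_of_summable_norm h1 h2
    have hs := (summable_norm_sum_mul_antidiagonal_of_summable_norm h1 h2).of_norm
    have h3 := hs.hasSum
    rw [← h, (hf.hasSum z).tsum_eq, (hg.hasSum z).tsum_eq] at h3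
    refine Eq.subst (motive := fun u => HasSum u _) (funext fun n => ?_) h3
    rw [PowerSeries.coeff_mul, Finset.sum_mul]
    refine Finset.sum_congr rfl fun x hx => ?_
    rw [← Finset.HasAntidiagonal.mem_antidiagonal.mp hx, pow_add]
    exact mul_mul_mul_comm _ _ _ _

/-- The derivation `D = (2 π i)⁻¹ d/dz = q d/dq` may be applied termwise. -/
lemma deriv (hf : HasQExpansion f p) :
    HasQExpansion (Derivative.normalizedDerivOfComplex f) (.mk fun n => n * p.coeff n) where
  mdiff := Derivative.normalizedDerivOfComplex_mdifferentiable hf.mdiff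
  hasSum z := by
    set U : Set ℂ := {w | z.im / 2 < w.im} with hU
    have hUo : IsOpen U := isOpen_lt continuous_const Complex.continuous_im
    have hz : (z : ℂ) ∈ U := by simp [hU, z.im_pos]
    let F : ℕ → ℂ → ℂ := fun n w => p.coeff n * Function.Periodic.qParam 1 w ^ n
    -- the terms are largest, in absolute value, at the bottom of the half-plane `U`
    let z' : ℍ := ⟨(z.im / 2 : ℝ) * Complex.I, by simpa using z.im_pos⟩
    have hdq (w : ℂ) : HasDerivAt (fun w => Function.Periodic.qParam 1 w)
        (2 * Real.pi * Complex.I * Function.Periodic.qParam 1 w) w := by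
      simp only [Function.Periodic.qParam, Complex.ofReal_one, div_one]
      exact (((hasDerivAt_id w).const_mul (2 * Real.pi * Complex.I)).cexp).congr_deriv
        (by rw [mul_one]; exact mul_comm _ _)
    have hdF (n : ℕ) (w : ℂ) : HasDerivAt (F n)
        (2 * Real.pi * Complex.I * (n * p.coeff n * Function.Periodic.qParam 1 w ^ n)) w := by
      refine (((hdq w).pow n).const_mul (p.coeff n)).congr_deriv ?_
      rcases n with _ | n
      · simp
      · rw [Nat.add_sub_cancel, pow_succ]; ring
    have hle (n : ℕ) (w : ℂ) (hw : w ∈ U) : ‖F n w‖ ≤ ‖F n z'‖ := by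
      simp only [F, norm_mul, norm_pow]
      gcongr
      rw [Function.Periodic.norm_qParam, Function.Periodic.norm_qParam]
      have : z.im / 2 ≤ w.im := le_of_lt hw
      have h2 : ((z' : ℍ) : ℂ).im = z.im / 2 := by simp [z']
      rw [h2, Real.exp_le_exp, div_one, div_one]
      nlinarith [Real.pi_pos]
    have key := Complex.hasSum_deriv_of_summable_norm (hf.hasSum z').summable.norm
      (fun n w _ => (hdF n w).differentiableAt.differentiableWithinAt) hUo hle hz
    have heq : (fun w => ∑' n, F n w) =ᶠ[nhds (z : ℂ)] f ∘ ofComplex := by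
      filter_upwards [isOpen_upperHalfPlaneSet.mem_nhds z.im_pos] with w hw
      rw [Function.comp_apply, ofComplex_apply_of_im_pos hw]
      exact (hf.hasSum ⟨w, hw⟩).tsum_eq
    rw [heq.deriv_eq] at key
    simp only [(hdF _ _).deriv] at key
    have hpi : (2 * Real.pi * Complex.I : ℂ) ≠ 0 := Complex.two_pi_I_ne_zero
    have := key.mul_left (2 * Real.pi * Complex.I)⁻¹
    simp only [inv_mul_cancel_left₀ hpi] at this
    simp only [PowerSeries.coeff_mk]
    exact this

end HasQExpansion

/-! ### Modular forms of level one and Ramanujan's identities -/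

section

open ModularForm EisensteinSeries Derivative

lemma ModularForm.hasQExpansion {k : ℤ} (f : ModularForm 𝒮ℒ k) :
    HasQExpansion f (qExpansion 1 f) where
  mdiff := ModularFormClass.holo f
  hasSum z := ModularForm.hasSum_qExpansion f one_pos one_mem_strictPeriods_SL z

lemma ModularForm.slash_SL_eq {k : ℤ} (f : ModularForm 𝒮ℒ k) (γ : SL(2, ℤ)) :
    (f : ℍ → ℂ) ∣[k] γ = f :=
  SlashInvariantFormClass.slash_action_eq f _ ⟨γ, rfl⟩

/-- The modular form of level one attached to a holomorphic function that is invariant under all of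
`SL(2, ℤ)` and bounded at `i∞`. -/
def ModularForm.ofSlashInvariant {k : ℤ} (f : ℍ → ℂ) (hf : MDiff f)
    (hinv : ∀ γ : SL(2, ℤ), f ∣[k] γ = f) (hbdd : IsBoundedAtImInfty f) : ModularForm 𝒮ℒ k where
  toFun := f
  slash_action_eq' := by
    rintro _ ⟨γ, rfl⟩
    exact hinv γ
  holo' := hf
  bdd_at_cusps' {c} hc := by
    rw [OnePoint.isBoundedAt_iff_forall_SL2Z hc]
    intro γ _
    rwa [hinv γ]

@[simp]
lemma ModularForm.coe_ofSlashInvariant {k : ℤ} (f : ℍ → ℂ) (hf : MDiff f)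
    (hinv : ∀ γ : SL(2, ℤ), f ∣[k] γ = f) (hbdd : IsBoundedAtImInfty f) :
    (ModularForm.ofSlashInvariant f hf hinv hbdd : ℍ → ℂ) = f := rfl

/-- In weight less than `12`, a modular form of level one is determined by its constant term. The
weights of the two forms are only assumed propositionally equal. -/
lemma ModularForm.eq_smul_of_weight_lt_twelve {k l : ℤ} (hkl : k = l) (hk : k < 12)
    {g : ModularForm 𝒮ℒ l} {r : PowerSeries ℂ} (hg : HasQExpansion g r) (hr : r.coeff 0 = 1)
    {f : ModularForm 𝒮ℒ k} {p : PowerSeries ℂ} (hf : HasQExpansion f p) :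
    (f : ℍ → ℂ) = p.coeff 0 • (g : ℍ → ℂ) := by
  subst hkl
  have h := hf.sub (hg.smul (p.coeff 0))
  have hq : qExpansion 1 (f - p.coeff 0 • g : ModularForm 𝒮ℒ k) = p - p.coeff 0 • r :=
    h.qExpansion_eq
  have h0 : f - p.coeff 0 • g = 0 := by
    apply sturm_bound_levelOne
    have : k.toNat / 12 = 0 := by omega
    rw [this, hq, Nat.cast_zero]
    refine lt_of_lt_of_le zero_lt_one (PowerSeries.nat_le_order _ 1 fun i hi => ?_)
    obtain rfl : i = 0 := by omega
    rw [map_sub, PowerSeries.coeff_smul, hr]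
    simp
  rw [sub_eq_zero] at h0
  exact congrArg DFunLike.coe h0

/-- The power series `1 + c ∑ σₖ(n) qⁿ`, the shape of the `q`-expansion of an Eisenstein series. -/
noncomputable def eisensteinQSeries (c : ℂ) (k : ℕ) : PowerSeries ℂ :=
  .mk fun n => if n = 0 then 1 else c * (ArithmeticFunction.sigma k n : ℂ)

lemma coeff_eisensteinQSeries (c : ℂ) (k n : ℕ) : (eisensteinQSeries c k).coeff n =
    if n = 0 then 1 else c * (ArithmeticFunction.sigma k n : ℂ) :=
  PowerSeries.coeff_mk _ _

@[simp]
lemma constantCoeff_eisensteinQSeries (c : ℂ) (k : ℕ) :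
    (eisensteinQSeries c k).constantCoeff = 1 := by
  simp [← PowerSeries.coeff_zero_eq_constantCoeff_apply, coeff_eisensteinQSeries]

lemma hasQExpansion_E2 :
    HasQExpansion E2 (eisensteinQSeries (-24) 1) where
  mdiff := E2_mdifferentiable
  hasSum z := by
    simp only [coeff_eisensteinQSeries, Function.Periodic.qParam, Complex.ofReal_one, div_one]
    exact hasSum_qExpansion_E2 z

lemma hasQExpansion_E {k : ℕ} (hk : 3 ≤ k) (hk2 : Even k) {c : ℚ}
    (hc : -(2 * k / bernoulli k) = c) : HasQExpansion (E hk) (eisensteinQSeries c (k - 1)) := by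
  convert (E hk).hasQExpansion using 1
  ext n
  rw [E_qExpansion_coeff hk hk2, coeff_eisensteinQSeries, ← hc]
  push_cast
  rfl

lemma hasQExpansion_E₄ :
    HasQExpansion E₄ (eisensteinQSeries 240 3) := by
  simpa using! hasQExpansion_E (k := 4) (by norm_num) ⟨2, rfl⟩ (c := 240)
    (by rw [show bernoulli 4 = -1 / 30 by decide +kernel]; norm_num)

lemma hasQExpansion_E₆ :
    HasQExpansion E₆ (eisensteinQSeries (-504) 5) := by
  simpa using! hasQExpansion_E (k := 6) (by norm_num) ⟨3, rfl⟩ (c := -504)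
    (by rw [show bernoulli 6 = 1 / 42 by decide +kernel]; norm_num)

lemma hasQExpansion_E₈ : HasQExpansion (E (k := 8) (by norm_num))
    (eisensteinQSeries 480 7) := by
  simpa using! hasQExpansion_E (k := 8) (by norm_num) ⟨4, rfl⟩ (c := 480)
    (by rw [show bernoulli 8 = -1 / 30 by decide +kernel]; norm_num)

lemma hasQExpansion_E₁₀ : HasQExpansion (E (k := 10) (by norm_num))
    (eisensteinQSeries (-264) 9) := by
  simpa using! hasQExpansion_E (k := 10) (by norm_num) ⟨5, rfl⟩ (c := -264)
    (by rw [show bernoulli 10 = 5 / 66 by decide +kernel]; norm_num)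

/-- The space of modular forms of weight `8` is one-dimensional, so `E₄ ^ 2 = E₈`. -/
lemma hasQExpansion_E₄_sq : HasQExpansion ((E₄ : ℍ → ℂ) * E₄)
    (eisensteinQSeries 480 7) := by
  have h := ModularForm.eq_smul_of_weight_lt_twelve (f := E₄.mul E₄) (by norm_num) (by norm_num)
    hasQExpansion_E₈ (by simp) (hasQExpansion_E₄.mul hasQExpansion_E₄)
  rw [ModularForm.coe_mul] at h
  rw [h]
  simpa using! hasQExpansion_E₈

/-- The space of modular forms of weight `10` is one-dimensional, so `E₄ E₆ = E₁₀`. -/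
lemma hasQExpansion_E₄_mul_E₆ : HasQExpansion ((E₄ : ℍ → ℂ) * E₆)
    (eisensteinQSeries (-264) 9) := by
  have h := ModularForm.eq_smul_of_weight_lt_twelve (f := E₄.mul E₆) (by norm_num) (by norm_num)
    hasQExpansion_E₁₀ (by simp) (hasQExpansion_E₄.mul hasQExpansion_E₆)
  rw [ModularForm.coe_mul] at h
  rw [h]
  simpa using! hasQExpansion_E₁₀

lemma HasQExpansion.serreDerivative {f : ℍ → ℂ} {p : PowerSeries ℂ} (hf : HasQExpansion f p)
    (k : ℂ) : HasQExpansion (Derivative.serreDerivative k f)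
      (.mk (fun n => n * p.coeff n) - (k * 12⁻¹) •
        (eisensteinQSeries (-24) 1 * p)) := by
  convert hf.deriv.sub ((hasQExpansion_E2.mul hf).smul (k * 12⁻¹)) using 1
  ext z
  simp [mul_assoc]

/-- The Serre derivative of a level one modular form is again a modular form. -/
noncomputable def ModularForm.serreDeriv {k : ℤ} (f : ModularForm 𝒮ℒ k) : ModularForm 𝒮ℒ (k + 2) :=
  .ofSlashInvariant (Derivative.serreDerivative k f)
    (serreDerivative_mdifferentiable _ f.hasQExpansion.mdiff)
    (fun γ => serreDerivative_slash_invariant f.hasQExpansion.mdiff (f.slash_SL_eq γ))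
    (f.hasQExpansion.serreDerivative k).isBoundedAtImInfty

/-- Ramanujan's identity for the derivative of `E₄`. -/
lemma deriv_E₄ : normalizedDerivOfComplex E₄ = (3⁻¹ : ℂ) • (E2 * E₄ - E₆) := by
  have h := ModularForm.eq_smul_of_weight_lt_twelve (f := E₄.serreDeriv) (by norm_num) (by norm_num)
    hasQExpansion_E₆ (by simp) (hasQExpansion_E₄.serreDerivative _)
  ext z
  have hz := congrFun h z
  simp [ModularForm.serreDeriv] at hz
  simp
  linear_combination hz

/-- Ramanujan's identity for the derivative of `E₆`. -/
lemma deriv_E₆ : normalizedDerivOfComplex E₆ = (2⁻¹ : ℂ) • (E2 * E₆ - E₄ * E₄) := by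
  have h := ModularForm.eq_smul_of_weight_lt_twelve (f := E₆.serreDeriv) (g := E₄.mul E₄)
    (by norm_num) (by norm_num) hasQExpansion_E₄_sq (by simp) (hasQExpansion_E₆.serreDerivative _)
  rw [ModularForm.coe_mul] at h
  ext z
  have hz := congrFun h z
  simp [ModularForm.serreDeriv] at hz
  simp
  linear_combination hz

/-- The function `c / (c z + d)` attached to the matrix `γ = (a b; c d)`. -/
noncomputable def slashCocycle (γ : SL(2, ℤ)) (z : ℍ) : ℂ := ((γ 1 0 : ℤ) : ℂ) / denom γ z

/-- The constant `12 / (2 π i)` in the transformation law of `E2`. -/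
noncomputable def E2Anomaly : ℂ := 12 * (2 * Real.pi * Complex.I)⁻¹

lemma E2Anomaly_ne_zero : E2Anomaly ≠ 0 :=
  mul_ne_zero (by norm_num) (inv_ne_zero Complex.two_pi_I_ne_zero)

/-- `E2` is a quasimodular form: it fails to be modular by a multiple of `c / (c z + d)`. -/
lemma E2_slash_eq (γ : SL(2, ℤ)) :
    E2 ∣[(2 : ℤ)] γ = E2 + E2Anomaly • slashCocycle γ := by
  rw [E2_slash_action]
  ext z
  have hpi : (Real.pi : ℂ) ≠ 0 := by exact_mod_cast Real.pi_ne_zero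
  simp only [D2, slashCocycle, E2Anomaly, riemannZeta_two, Pi.sub_apply, Pi.add_apply,
    Pi.smul_apply, smul_eq_mul]
  field_simp
  linear_combination (-12 * ((γ 1 0 : ℤ) : ℂ)) * Complex.I_sq

lemma slashCocycle_apply (γ : SL(2, ℤ)) (z : ℍ) :
    slashCocycle γ z = ((γ 1 0 : ℤ) : ℂ) / (((γ 1 0 : ℤ) : ℂ) * z + ((γ 1 1 : ℤ) : ℂ)) := by
  simp [slashCocycle, denom]

lemma slashCocycle_eq_smul_slash (γ : SL(2, ℤ)) :
    slashCocycle γ = ((γ 1 0 : ℤ) : ℂ) • ((fun _ => 1 : ℍ → ℂ) ∣[(1 : ℤ)] γ) := by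
  ext z
  simp [slashCocycle, ModularForm.SL_slash_apply, div_eq_mul_inv]

lemma mdiff_slashCocycle (γ : SL(2, ℤ)) : MDiff (slashCocycle γ) := by
  rw [slashCocycle_eq_smul_slash]
  exact (mdifferentiable_const.slash _ _).const_smul _

/-- The cocycle `κ = c / (c z + d)` satisfies the Riccati equation `κ' = -κ ^ 2`, up to the
normalization of the derivative. -/
lemma deriv_slashCocycle (γ : SL(2, ℤ)) : normalizedDerivOfComplex (slashCocycle γ) =
    -(2 * Real.pi * Complex.I : ℂ)⁻¹ • (slashCocycle γ * slashCocycle γ) := by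
  have hc : MDiff (fun _ => 1 : ℍ → ℂ) := mdifferentiable_const
  have h1 := normalizedDerivOfComplex_SL_slash (k := 1) (γ := γ) hc
  have h2 := normalizedDerivOfComplex_smul ((γ 1 0 : ℤ) : ℂ) _ (hc.slash 1 γ)
  rw [← ModularForm.SL_slash, ← slashCocycle_eq_smul_slash, h1,
    normalizedDerivOfComplex_const] at h2
  rw [h2]
  ext z
  simp [slashCocycle, ModularForm.SL_slash_apply, div_eq_mul_inv]
  ring

/-- Ramanujan's identity for the derivative of `E2`. The anomalies of `D E2` and `E2 ^ 2 / 12` under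
`SL(2, ℤ)` cancel, so their difference is a modular form of weight `4`. -/
lemma deriv_E2 : normalizedDerivOfComplex E2 = (12⁻¹ : ℂ) • (E2 * E2 - E₄) := by
  have hq := hasQExpansion_E2.deriv.sub ((hasQExpansion_E2.mul hasQExpansion_E2).smul 12⁻¹)
  have hinv (γ : SL(2, ℤ)) :
      (normalizedDerivOfComplex E2 - (12⁻¹ : ℂ) • (E2 * E2)) ∣[(4 : ℤ)] γ =
        normalizedDerivOfComplex E2 - (12⁻¹ : ℂ) • (E2 * E2) := by
    have h1 := normalizedDerivOfComplex_SL_slash (k := 2) (γ := γ) E2_mdifferentiable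
    rw [E2_slash_eq, normalizedDerivOfComplex_add _ _ E2_mdifferentiable
      ((mdiff_slashCocycle γ).const_smul _), normalizedDerivOfComplex_smul _ _
      (mdiff_slashCocycle γ), deriv_slashCocycle] at h1
    have h2 := ModularForm.mul_slash_SL2 2 2 γ E2 E2
    rw [E2_slash_eq] at h2
    rw [E2Anomaly] at h1 h2
    generalize (2 * Real.pi * Complex.I : ℂ)⁻¹ = β at h1 h2
    rw [show (2 : ℤ) + 2 = 4 from rfl] at h1 h2
    ext z
    have h1z := congrFun h1 z
    have h2z := congrFun h2 z
    have hκ : ((γ 1 0 : ℤ) : ℂ) / denom γ z = slashCocycle γ z := rfl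
    simp [sub_eq_add_neg, ModularForm.SL_smul_slash, hκ] at h1z h2z ⊢
    rw [h2z]
    linear_combination -h1z
  have h := ModularForm.eq_smul_of_weight_lt_twelve
    (f := .ofSlashInvariant _ hq.mdiff hinv hq.isBoundedAtImInfty)
    rfl (by norm_num) hasQExpansion_E₄ (by simp) hq
  ext z
  have hz := congrFun h z
  simp at hz
  simp
  linear_combination hz

/-! ### The structure of quasimodular forms of depth two -/

lemma ModularForm.mul_slash_SL2_of_add_eq {k l m : ℤ} (h : k + l = m) (γ : SL(2, ℤ))
    (f g : ℍ → ℂ) : (f * g) ∣[m] γ = f ∣[k] γ * g ∣[l] γ :=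
  h ▸ ModularForm.mul_slash_SL2 k l γ f g

lemma slashCocycle_one : slashCocycle 1 = 0 := by
  ext z
  simp [slashCocycle]

lemma slashCocycle_mul (A B : SL(2, ℤ)) :
    slashCocycle (A * B) = slashCocycle A ∣[(2 : ℤ)] B + slashCocycle B := by
  have h (γ : SL(2, ℤ)) : D2 γ = (2 * Real.pi * Complex.I : ℂ) • slashCocycle γ := by
    ext z
    simp [D2, slashCocycle, mul_div_assoc]
  have := D2_mul A B
  rw [h, h, h, ModularForm.SL_smul_slash, ← smul_add] at this
  exact smul_right_injective _ Complex.two_pi_I_ne_zero this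

/-- `|c / (c z + d)|` is at most `1 / Im z`. -/
lemma isBoundedAtImInfty_slashCocycle (γ : SL(2, ℤ)) : IsBoundedAtImInfty (slashCocycle γ) := by
  rw [isBoundedAtImInfty_iff]
  refine ⟨1, 1, fun z hz => ?_⟩
  rw [slashCocycle, norm_div]
  refine div_le_one_of_le₀ ?_ (norm_nonneg _)
  have h1 : (denom γ z).im = ((γ 1 0 : ℤ) : ℝ) * z.im := by
    simp [denom]
  have h2 := Complex.abs_im_le_norm (denom γ z)
  rw [h1, abs_mul, abs_of_pos z.im_pos] at h2
  have h3 : ‖((γ 1 0 : ℤ) : ℂ)‖ = |((γ 1 0 : ℤ) : ℝ)| := by simp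
  rw [h3]
  exact le_trans (le_mul_of_one_le_right (abs_nonneg _) hz) h2

lemma UpperHalfPlane.IsBoundedAtImInfty.const_smul {f : ℍ → ℂ} (hf : IsBoundedAtImInfty f)
    (c : ℂ) : IsBoundedAtImInfty (c • f) :=
  Filter.BoundedAtFilter.smul c hf

lemma UpperHalfPlane.IsBoundedAtImInfty.sub {f g : ℍ → ℂ} (hf : IsBoundedAtImInfty f)
    (hg : IsBoundedAtImInfty g) : IsBoundedAtImInfty (f - g) := by
  have h := Filter.BoundedAtFilter.add hf (hg.const_smul (-1))
  rwa [neg_one_smul, ← sub_eq_add_neg] at h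

lemma ModularForm.sub_slash_SL2 (k : ℤ) (γ : SL(2, ℤ)) (f g : ℍ → ℂ) :
    (f - g) ∣[k] γ = f ∣[k] γ - g ∣[k] γ := by
  rw [sub_eq_add_neg, SlashAction.add_slash, SlashAction.neg_slash, ← sub_eq_add_neg]

/-- Slashing a quadratic polynomial in `E2` with modular coefficients shifts `E2` by a multiple of
the cocycle. -/
lemma quadratic_slash {w : ℤ} (f₀ : ModularForm 𝒮ℒ w) (f₁ : ModularForm 𝒮ℒ (w - 2))
    (f₂ : ModularForm 𝒮ℒ (w - 4)) (γ : SL(2, ℤ)) :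
    ((f₀ : ℍ → ℂ) + E2 * f₁ + E2 * E2 * f₂) ∣[w] γ =
      f₀ + (E2 + E2Anomaly • slashCocycle γ) * f₁ +
        (E2 + E2Anomaly • slashCocycle γ) * (E2 + E2Anomaly • slashCocycle γ) * f₂ := by
  rw [SlashAction.add_slash, SlashAction.add_slash,
    ModularForm.mul_slash_SL2_of_add_eq (k := 2) (l := w - 2) (by ring),
    ModularForm.mul_slash_SL2_of_add_eq (k := 4) (l := w - 4) (by ring),
    ModularForm.mul_slash_SL2_of_add_eq (k := 2) (l := 2) (by ring), E2_slash_eq,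
    f₀.slash_SL_eq, f₁.slash_SL_eq, f₂.slash_SL_eq]

/-- A polynomial of degree two in `E2` with modular coefficients is a quasimodular form of depth
two. -/
theorem isQuasimodularForm_of_modularForm {w : ℤ} (f₀ : ModularForm 𝒮ℒ w)
    (f₁ : ModularForm 𝒮ℒ (w - 2)) (f₂ : ModularForm 𝒮ℒ (w - 4)) (Γ : Subgroup SL(2, ℤ)) :
    IsQuasimodularForm w 2 Γ ((f₀ : ℍ → ℂ) + E2 * f₁ + E2 * E2 * f₂) := by
  have m0 := f₀.hasQExpansion.mdiff
  have m1 := f₁.hasQExpansion.mdiff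
  have m2 := f₂.hasQExpansion.mdiff
  have b0 := f₀.hasQExpansion.isBoundedAtImInfty
  have b1 := f₁.hasQExpansion.isBoundedAtImInfty
  have b2 := f₂.hasQExpansion.isBoundedAtImInfty
  have hm : MDiff ((f₀ : ℍ → ℂ) + E2 * f₁ + E2 * E2 * f₂) :=
    (m0.add (E2_mdifferentiable.mul m1)).add ((E2_mdifferentiable.mul E2_mdifferentiable).mul m2)
  have hE (γ : SL(2, ℤ)) : IsBoundedAtImInfty (E2 + E2Anomaly • slashCocycle γ) :=
    isBoundedAtImInfty_E2.add ((isBoundedAtImInfty_slashCocycle γ).const_smul _)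
  refine ⟨hm, ![(f₀ : ℍ → ℂ) + E2 * f₁ + E2 * E2 * f₂,
    E2Anomaly • (f₁ + (2 : ℂ) • (E2 * f₂)), (E2Anomaly * E2Anomaly) • f₂], ?_, ?_, ?_⟩
  · intro r
    fin_cases r
    · exact hm
    · exact (m1.add ((E2_mdifferentiable.mul m2).const_smul _)).const_smul _
    · exact m2.const_smul _
  · intro r γ
    fin_cases r
    · simp only [Fin.zero_eta, Matrix.cons_val_zero, Nat.cast_zero, mul_zero, sub_zero]
      rw [quadratic_slash]
      exact (b0.add ((hE γ).mul b1)).add (((hE γ).mul (hE γ)).mul b2)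
    · simp only [Fin.mk_one, Matrix.cons_val_one, Matrix.cons_val_zero, Nat.cast_one,
        mul_one]
      rw [ModularForm.SL_smul_slash, SlashAction.add_slash, ModularForm.SL_smul_slash,
        ModularForm.mul_slash_SL2_of_add_eq (k := 2) (l := w - 4) (by ring), E2_slash_eq,
        f₁.slash_SL_eq, f₂.slash_SL_eq]
      exact IsBoundedAtImInfty.const_smul
        (b1.add (IsBoundedAtImInfty.const_smul ((hE γ).mul b2) _)) _
    · change IsBoundedAtImInfty (((E2Anomaly * E2Anomaly) • (f₂ : ℍ → ℂ)) ∣[w - 4] γ)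
      rw [ModularForm.SL_smul_slash, f₂.slash_SL_eq]
      exact IsBoundedAtImInfty.const_smul b2 _
  · intro γ _ z
    rw [quadratic_slash, Fin.sum_univ_three]
    simp [slashCocycle]
    ring

/-- The transformation law of the components of a quasimodular form of depth two: at a given point
`z` both sides of the functional equation are polynomials of degree two in `c / (c z + d)`, which
takes at least three values, so the coefficients agree. -/
lemma slash_components_eq {w : ℤ} {F G₀ G₁ G₂ : ℍ → ℂ}
    (hF : ∀ (γ : SL(2, ℤ)) (z : ℍ), (F ∣[w] γ) z =
      G₀ z + G₁ z * slashCocycle γ z + G₂ z * slashCocycle γ z ^ 2) (γ : SL(2, ℤ)) :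
    G₁ ∣[w - 2] γ = G₁ + (2 : ℂ) • (slashCocycle γ * G₂) ∧ G₂ ∣[w - 4] γ = G₂ := by
  have key (δ : SL(2, ℤ)) : G₀ + G₁ * slashCocycle δ + G₂ * slashCocycle δ ^ 2 =
      G₀ ∣[w] γ + G₁ ∣[w - 2] γ * (slashCocycle δ - slashCocycle γ) +
        G₂ ∣[w - 4] γ * (slashCocycle δ - slashCocycle γ) ^ 2 := by
    have hF' (γ : SL(2, ℤ)) : F ∣[w] γ = G₀ + G₁ * slashCocycle γ +
        G₂ * (slashCocycle γ * slashCocycle γ) := by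
      ext z
      rw [hF]
      simp [sq]
    have h1 := slashCocycle_mul (δ * γ⁻¹) γ
    have h2 := SlashAction.slash_mul w (δ * γ⁻¹) γ F
    rw [inv_mul_cancel_right] at h1 h2
    rw [hF', hF', SlashAction.add_slash, SlashAction.add_slash,
      ModularForm.mul_slash_SL2_of_add_eq (k := w - 2) (l := 2) (by ring),
      ModularForm.mul_slash_SL2_of_add_eq (k := w - 4) (l := 4) (by ring),
      ModularForm.mul_slash_SL2_of_add_eq (k := 2) (l := 2) (by ring)] at h2
    rw [sq, sq, h2, ← eq_sub_of_add_eq h1.symm]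
  suffices ∀ z, (G₁ ∣[w - 2] γ) z = G₁ z + 2 * (slashCocycle γ z * G₂ z) ∧
      (G₂ ∣[w - 4] γ) z = G₂ z from
    ⟨funext fun z => (this z).1, funext fun z => (this z).2⟩
  intro z
  -- the matrices `1`, `δ 1`, `δ (-1)` give the three values `0`, `1 / (z + 1)`, `-1 / (-z + 1)`
  let δ (n : ℤ) : SL(2, ℤ) := ⟨!![1, 0; n, 1], by simp⟩
  have hδ (n : ℤ) : slashCocycle (δ n) z = n / (n * z + 1) := by
    rw [slashCocycle_apply]
    simp [δ]
  have h0 := congrFun (key 1) z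
  have h1 := congrFun (key (δ 1)) z
  have h2 := congrFun (key (δ (-1))) z
  have hz1 : (z : ℂ) + 1 ≠ 0 := fun h => by
    have := congrArg Complex.im h
    simp at this
    exact z.im_ne_zero this
  have hz2 : -(z : ℂ) + 1 ≠ 0 := fun h => by
    have := congrArg Complex.im h
    simp at this
    exact z.im_ne_zero this
  simp [hδ, slashCocycle_one] at h0 h1 h2
  have e1 : ((z : ℂ) + 1)⁻¹ * ((z : ℂ) + 1) = 1 := inv_mul_cancel₀ hz1
  have e2 : -1 / (-(z : ℂ) + 1) * (-z + 1) = -1 := by field_simp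
  generalize slashCocycle γ z = κ at *
  generalize (G₁ ∣[w - 2] γ) z = H₁ at *
  generalize (G₂ ∣[w - 4] γ) z = H₂ at *
  rw [← inv_pow] at h1
  generalize ((z : ℂ) + 1)⁻¹ = t at *
  generalize -1 / (-(z : ℂ) + 1) = u at *
  have ht : t ≠ 0 := left_ne_zero_of_mul_eq_one e1
  have hu : u ≠ 0 := fun h => by simp [h] at e2
  have htu : t - u ≠ 0 := fun h => by
    obtain rfl : t = u := sub_eq_zero.mp h
    have : 2 * t = 0 := by linear_combination e1 + e2
    simp [ht] at this
  have l1 : (G₁ z - H₁ + 2 * κ * H₂) + (G₂ z - H₂) * t = 0 :=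
    mul_left_cancel₀ ht (by linear_combination h1 - h0)
  have l2 : (G₁ z - H₁ + 2 * κ * H₂) + (G₂ z - H₂) * u = 0 :=
    mul_left_cancel₀ hu (by linear_combination h2 - h0)
  have l3 : H₂ = G₂ z := mul_left_cancel₀ htu (by linear_combination l2 - l1)
  exact ⟨by linear_combination -l1 + (2 * κ - t) * l3, l3⟩

/-- Every quasimodular form of level one and depth at most two is a polynomial of degree at most
two in `E2` whose coefficients are modular forms. -/
theorem IsQuasimodularForm.exists_modularForm {w : ℤ} {F : ℍ → ℂ}
    (hF : IsQuasimodularForm w 2 ⊤ F) :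
    ∃ (f₀ : ModularForm 𝒮ℒ w) (f₁ : ModularForm 𝒮ℒ (w - 2)) (f₂ : ModularForm 𝒮ℒ (w - 4)),
      F = (f₀ : ℍ → ℂ) + E2 * f₁ + E2 * E2 * f₂ := by
  obtain ⟨mF, G, mG, bG, hG⟩ := hF
  have hF (γ : SL(2, ℤ)) (z : ℍ) : (F ∣[w] γ) z =
      G 0 z + G 1 z * slashCocycle γ z + G 2 z * slashCocycle γ z ^ 2 := by
    rw [hG γ (Subgroup.mem_top γ), Fin.sum_univ_three]
    simp [slashCocycle]
  have hFG : F = G 0 := by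
    ext z
    simpa [slashCocycle_one] using hF 1 z
  have b (r : Fin 3) : IsBoundedAtImInfty (G r) := by
    simpa using bG r 1
  -- the coefficients solve the linear system that expresses `G` in terms of `f₀, f₁, f₂`
  set f₁ : ℍ → ℂ := E2Anomaly⁻¹ • (G 1 - (2 * E2Anomaly⁻¹) • (E2 * G 2)) with hf₁
  set f₂ : ℍ → ℂ := (E2Anomaly⁻¹ * E2Anomaly⁻¹) • G 2 with hf₂
  have m₁ : MDiff f₁ := ((mG 1).sub ((E2_mdifferentiable.mul (mG 2)).const_smul _)).const_smul _
  have m₂ : MDiff f₂ := (mG 2).const_smul _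
  have b₁ : IsBoundedAtImInfty f₁ := by
    exact ((b 1).sub
      (IsBoundedAtImInfty.const_smul (isBoundedAtImInfty_E2.mul (b 2)) _)).const_smul _
  have b₂ : IsBoundedAtImInfty f₂ := (b 2).const_smul _
  have hα := E2Anomaly_ne_zero
  have inv₂ (γ : SL(2, ℤ)) : f₂ ∣[w - 4] γ = f₂ := by
    rw [hf₂, ModularForm.SL_smul_slash, (slash_components_eq hF γ).2]
  have inv₁ (γ : SL(2, ℤ)) : f₁ ∣[w - 2] γ = f₁ := by
    rw [hf₁, ModularForm.SL_smul_slash, ModularForm.sub_slash_SL2,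
      ModularForm.SL_smul_slash, (slash_components_eq hF γ).1,
      ModularForm.mul_slash_SL2_of_add_eq (k := 2) (l := w - 4) (by ring), E2_slash_eq,
      (slash_components_eq hF γ).2]
    ext z
    simp [hα]
    field_simp
    ring
  set f₀ : ℍ → ℂ := F - (E2 * f₁ + E2 * E2 * f₂) with hf₀
  have m₀ : MDiff f₀ := mF.sub ((E2_mdifferentiable.mul m₁).add
    ((E2_mdifferentiable.mul E2_mdifferentiable).mul m₂))
  have b₀ : IsBoundedAtImInfty f₀ := by
    rw [hf₀, hFG]
    exact (b 0).sub ((isBoundedAtImInfty_E2.mul b₁).add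
      ((isBoundedAtImInfty_E2.mul isBoundedAtImInfty_E2).mul b₂))
  have inv₀ (γ : SL(2, ℤ)) : f₀ ∣[w] γ = f₀ := by
    rw [hf₀, ModularForm.sub_slash_SL2, SlashAction.add_slash,
      ModularForm.mul_slash_SL2_of_add_eq (k := 2) (l := w - 2) (by ring),
      ModularForm.mul_slash_SL2_of_add_eq (k := 4) (l := w - 4) (by ring),
      ModularForm.mul_slash_SL2_of_add_eq (k := 2) (l := 2) (by ring), E2_slash_eq, inv₁, inv₂]
    ext z
    have := hF γ z
    simp [hFG, hf₁, hf₂] at this ⊢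
    rw [this]
    field_simp
    ring
  refine ⟨.ofSlashInvariant f₀ m₀ inv₀ b₀, .ofSlashInvariant f₁ m₁ inv₁ b₁,
    .ofSlashInvariant f₂ m₂ inv₂ b₂, ?_⟩
  simp only [ModularForm.coe_ofSlashInvariant, hf₀]
  ring

/-! ### The substitution `z ↦ 2 z` -/

lemma mdiff_comp_doublePoint {f : ℍ → ℂ} (hf : MDiff f) : MDiff (f ∘ doublePoint) := by
  rw [mdifferentiable_iff] at hf ⊢
  have h : DifferentiableOn ℂ ((f ∘ ofComplex) ∘ fun w => 2 * w) {w | 0 < w.im} :=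
    hf.comp (by fun_prop) fun w hw => by simpa using hw
  refine h.congr fun w hw => ?_
  have hw' : 0 < (2 * w).im := by simpa using hw
  simp only [Function.comp_apply]
  rw [ofComplex_apply_of_im_pos hw, ofComplex_apply_of_im_pos hw']
  rfl

/-- A division-free description of the slash action, with `τ'` in place of `γ • τ`. -/
lemma slash_apply_eq_of_coe_eq {k : ℤ} (f : ℍ → ℂ) (γ : SL(2, ℤ)) {τ τ' : ℍ}
    (h : (τ' : ℂ) * (((γ 1 0 : ℤ) : ℂ) * τ + ((γ 1 1 : ℤ) : ℂ)) =
      ((γ 0 0 : ℤ) : ℂ) * τ + ((γ 0 1 : ℤ) : ℂ)) :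
    (f ∣[k] γ) τ = f τ' * (((γ 1 0 : ℤ) : ℂ) * τ + ((γ 1 1 : ℤ) : ℂ)) ^ (-k) := by
  have hd : denom γ τ = ((γ 1 0 : ℤ) : ℂ) * τ + ((γ 1 1 : ℤ) : ℂ) := by simp [denom]
  have hd0 := denom_ne_zero (γ : GL (Fin 2) ℝ) τ
  rw [hd] at hd0
  have : γ • τ = τ' := by
    ext
    rw [UpperHalfPlane.coe_specialLinearGroup_apply]
    simp
    rw [← h]
    field_simp
  rw [ModularForm.SL_slash_apply, this, hd]

lemma coe_smul_mul (γ : SL(2, ℤ)) (z : ℍ) :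
    ((γ • z : ℍ) : ℂ) * (((γ 1 0 : ℤ) : ℂ) * z + ((γ 1 1 : ℤ) : ℂ)) =
      ((γ 0 0 : ℤ) : ℂ) * z + ((γ 0 1 : ℤ) : ℂ) := by
  have hd : denom γ z = ((γ 1 0 : ℤ) : ℂ) * z + ((γ 1 1 : ℤ) : ℂ) := by simp [denom]
  have hd0 := denom_ne_zero (γ : GL (Fin 2) ℝ) z
  rw [hd] at hd0
  rw [UpperHalfPlane.coe_specialLinearGroup_apply]
  simpa using div_mul_cancel₀ _ hd0

lemma slash_eq_mul_zpow (k : ℤ) (f : ℍ → ℂ) (γ : SL(2, ℤ)) (z : ℍ) :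
    (f ∣[k] γ) z = f (γ • z) * (((γ 1 0 : ℤ) : ℂ) * z + ((γ 1 1 : ℤ) : ℂ)) ^ (-k) :=
  slash_apply_eq_of_coe_eq f γ (coe_smul_mul γ z)

/-- The matrix `(a 2b; c/2 d)`, which acts on `2 z` as `(a b; c d)` acts on `z`. -/
def halveLowerLeft (γ : SL(2, ℤ)) (h : 2 ∣ γ 1 0) : SL(2, ℤ) :=
  ⟨!![γ 0 0, 2 * γ 0 1; γ 1 0 / 2, γ 1 1], by
    have := γ.det_coe
    rw [Matrix.det_fin_two] at this
    rw [Matrix.det_fin_two_of]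
    obtain ⟨c, hc⟩ := h
    rw [hc, Int.mul_ediv_cancel_left _ two_ne_zero]
    rw [hc] at this
    linear_combination this⟩

lemma comp_doublePoint_slash (k : ℤ) (f : ℍ → ℂ) (γ : SL(2, ℤ)) (h : 2 ∣ γ 1 0) :
    (f ∘ doublePoint) ∣[k] γ = (f ∣[k] halveLowerLeft γ h) ∘ doublePoint := by
  ext z
  have hz := coe_smul_mul γ z
  have hc : (((γ 1 0 / 2 : ℤ) : ℤ) : ℂ) * 2 = ((γ 1 0 : ℤ) : ℂ) := by
    exact_mod_cast Int.ediv_mul_cancel h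
  have hd : (((γ 1 0 / 2 : ℤ) : ℤ) : ℂ) * (2 * z) + ((γ 1 1 : ℤ) : ℂ) =
      ((γ 1 0 : ℤ) : ℂ) * z + ((γ 1 1 : ℤ) : ℂ) := by
    linear_combination (z : ℂ) * hc
  rw [slash_eq_mul_zpow, Function.comp_apply, Function.comp_apply,
    slash_apply_eq_of_coe_eq f (halveLowerLeft γ h) (τ' := doublePoint (γ • z))]
  · simp only [halveLowerLeft, doublePoint, Matrix.of_apply, Matrix.cons_val',
      Matrix.cons_val_zero, Matrix.cons_val_one, Matrix.cons_val_fin_one]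
    rw [hd]
  · simp only [halveLowerLeft, doublePoint, Matrix.of_apply, Matrix.cons_val',
      Matrix.cons_val_zero, Matrix.cons_val_one, Matrix.cons_val_fin_one]
    rw [hd]
    push_cast
    linear_combination 2 * hz

/-- The factor `(2a  b-ad; c  d(1-c)/2)` of `(2 0; 0 1) (a b; c d)`, for odd `c`, whose cofactor is
the upper triangular matrix `(1 d; 0 2)`. -/
def doubleUpperLeft (γ : SL(2, ℤ)) (h : ¬ 2 ∣ γ 1 0) : SL(2, ℤ) :=
  ⟨!![2 * γ 0 0, γ 0 1 - γ 0 0 * γ 1 1; γ 1 0, γ 1 1 * ((1 - γ 1 0) / 2)], by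
    have := γ.det_coe
    rw [Matrix.det_fin_two] at this
    rw [Matrix.det_fin_two_of]
    obtain ⟨c, hc⟩ : 2 ∣ 1 - γ 1 0 := by omega
    rw [hc, Int.mul_ediv_cancel_left _ two_ne_zero]
    linear_combination this - γ 0 0 * γ 1 1 * hc⟩

/-- The point `(z + d) / 2` of the upper half-plane. -/
noncomputable def halfPoint (d : ℤ) (z : ℍ) : ℍ :=
  ⟨((z : ℂ) + d) / 2, by simpa using z.im_pos⟩

lemma comp_doublePoint_slash_of_odd (k : ℤ) (f : ℍ → ℂ) (γ : SL(2, ℤ)) (h : ¬ 2 ∣ γ 1 0) :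
    (f ∘ doublePoint) ∣[k] γ =
      (2 : ℂ) ^ (-k) • ((f ∣[k] doubleUpperLeft γ h) ∘ halfPoint (γ 1 1)) := by
  ext z
  have hz := coe_smul_mul γ z
  have hdet : ((γ 0 0 : ℤ) : ℂ) * ((γ 1 1 : ℤ) : ℂ) -
      ((γ 0 1 : ℤ) : ℂ) * ((γ 1 0 : ℤ) : ℂ) = 1 := by
    have := γ.det_coe
    rw [Matrix.det_fin_two] at this
    exact_mod_cast this
  have hc : (((1 - γ 1 0) / 2 : ℤ) : ℂ) * 2 = 1 - ((γ 1 0 : ℤ) : ℂ) := by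
    exact_mod_cast Int.ediv_mul_cancel (by omega : (2 : ℤ) ∣ 1 - γ 1 0)
  have hd : ((γ 1 0 : ℤ) : ℂ) * ((z + ((γ 1 1 : ℤ) : ℂ)) / 2) +
      ((γ 1 1 : ℤ) : ℂ) * (((1 - γ 1 0) / 2 : ℤ) : ℂ) =
      2⁻¹ * (((γ 1 0 : ℤ) : ℂ) * z + ((γ 1 1 : ℤ) : ℂ)) := by
    linear_combination (((γ 1 1 : ℤ) : ℂ) / 2) * hc
  rw [slash_eq_mul_zpow, Pi.smul_apply, Function.comp_apply, Function.comp_apply,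
    slash_apply_eq_of_coe_eq f (doubleUpperLeft γ h) (τ' := doublePoint (γ • z))]
  · simp only [doubleUpperLeft, halfPoint, Matrix.of_apply, Matrix.cons_val', Matrix.cons_val_zero,
      Matrix.cons_val_one, Matrix.cons_val_fin_one, Int.cast_mul]
    rw [hd, mul_zpow, inv_zpow, smul_eq_mul]
    have : (2 : ℂ) ^ (-k) ≠ 0 := zpow_ne_zero _ two_ne_zero
    field_simp
  · simp only [doubleUpperLeft, doublePoint, halfPoint, Matrix.of_apply, Matrix.cons_val',
      Matrix.cons_val_zero, Matrix.cons_val_one, Matrix.cons_val_fin_one, Int.cast_mul,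
      Int.cast_sub]
    rw [hd]
    push_cast
    linear_combination hz

lemma isBoundedAtImInfty_comp {f : ℍ → ℂ} (hf : IsBoundedAtImInfty f) {φ : ℍ → ℍ}
    (hφ : ∀ z, z.im / 2 ≤ (φ z).im) : IsBoundedAtImInfty (f ∘ φ) := by
  rw [isBoundedAtImInfty_iff] at hf ⊢
  obtain ⟨M, A, h⟩ := hf
  exact ⟨M, 2 * A, fun z hz => h _ (by linarith [hφ z])⟩

lemma isBoundedAtImInfty_comp_doublePoint_slash {k : ℤ} {f : ℍ → ℂ}
    (hf : ∀ γ : SL(2, ℤ), IsBoundedAtImInfty (f ∣[k] γ)) (γ : SL(2, ℤ)) :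
    IsBoundedAtImInfty ((f ∘ doublePoint) ∣[k] γ) := by
  by_cases h : 2 ∣ γ 1 0
  · rw [comp_doublePoint_slash k f γ h]
    refine isBoundedAtImInfty_comp (hf _) fun z => ?_
    have : (doublePoint z).im = 2 * z.im := by simp [doublePoint, ← coe_im]
    linarith [z.im_pos]
  · rw [comp_doublePoint_slash_of_odd k f γ h]
    refine IsBoundedAtImInfty.const_smul (isBoundedAtImInfty_comp (hf _) fun z => ?_) _
    have : (halfPoint (γ 1 1) z).im = z.im / 2 := by simp [halfPoint, ← coe_im]
    exact this.ge

/-- The components of `z ↦ F (2 z)` are `2 ^ (-r) G r (2 z)`, because `c / 2` replaces `c` under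
`halveLowerLeft`. -/
lemma IsQuasimodularForm.comp_doublePoint {w : ℤ} {s : ℕ} {F : ℍ → ℂ}
    (hF : IsQuasimodularForm w s ⊤ F) :
    IsQuasimodularForm w s (CongruenceSubgroup.Gamma0 2) (F ∘ doublePoint) := by
  obtain ⟨mF, G, mG, bG, hG⟩ := hF
  refine ⟨mdiff_comp_doublePoint mF, fun r => (2⁻¹ : ℂ) ^ (r : ℕ) • (G r ∘ doublePoint),
    fun r => (mdiff_comp_doublePoint (mG r)).const_smul _, fun r γ => ?_, fun γ hγ z => ?_⟩
  · rw [ModularForm.SL_smul_slash]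
    exact (isBoundedAtImInfty_comp_doublePoint_slash (bG r) γ).const_smul _
  · have h2 : 2 ∣ γ 1 0 := by
      rw [CongruenceSubgroup.Gamma0_mem] at hγ
      exact_mod_cast (ZMod.intCast_zmod_eq_zero_iff_dvd _ 2).mp hγ
    rw [comp_doublePoint_slash w F γ h2, Function.comp_apply, hG _ (Subgroup.mem_top _)]
    refine Finset.sum_congr rfl fun r _ => ?_
    have : slashCocycle (halveLowerLeft γ h2) (doublePoint z) = 2⁻¹ * slashCocycle γ z := by
      have hc : (((γ 1 0 / 2 : ℤ) : ℤ) : ℂ) * 2 = ((γ 1 0 : ℤ) : ℂ) := by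
        exact_mod_cast Int.ediv_mul_cancel h2
      rw [slashCocycle_apply, slashCocycle_apply]
      simp only [halveLowerLeft, doublePoint, Matrix.of_apply, Matrix.cons_val',
        Matrix.cons_val_zero, Matrix.cons_val_one, Matrix.cons_val_fin_one]
      rw [← hc]
      ring
    change _ * slashCocycle (halveLowerLeft γ h2) (doublePoint z) ^ _ = _ * slashCocycle γ z ^ _
    rw [this, mul_pow]
    simp only [Pi.smul_apply, Function.comp_apply, smul_eq_mul]
    ring

lemma IsQuasimodularForm.sub_smul {w : ℤ} {s : ℕ} {Γ : Subgroup SL(2, ℤ)} {F F' : ℍ → ℂ}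
    (hF : IsQuasimodularForm w s Γ F) (hF' : IsQuasimodularForm w s Γ F') (c : ℂ) :
    IsQuasimodularForm w s Γ (F - c • F') := by
  obtain ⟨mF, G, mG, bG, hG⟩ := hF
  obtain ⟨mF', G', mG', bG', hG'⟩ := hF'
  refine ⟨mF.sub (mF'.const_smul c), fun r => G r - c • G' r,
    fun r => (mG r).sub ((mG' r).const_smul c), fun r γ => ?_, fun γ hγ z => ?_⟩
  · rw [ModularForm.sub_slash_SL2, ModularForm.SL_smul_slash]
    exact (bG r γ).sub ((bG' r γ).const_smul c)
  · rw [ModularForm.sub_slash_SL2, ModularForm.SL_smul_slash, Pi.sub_apply, Pi.smul_apply,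
      hG γ hγ, hG' γ hγ, smul_eq_mul, Finset.mul_sum, ← Finset.sum_sub_distrib]
    refine Finset.sum_congr rfl fun r _ => ?_
    simp
    ring

lemma isQuasimodularForm_extremalY {w : ℤ} {s : ℕ} {X : ℍ → ℂ} (hX : IsQuasimodularForm w s ⊤ X) :
    IsQuasimodularForm w s (CongruenceSubgroup.Gamma0 2) (extremalY w s X) := by
  obtain ⟨mF, G, mG, bG, hG⟩ := hX
  exact IsQuasimodularForm.sub_smul ⟨mF, G, mG, bG, fun γ _ => hG γ (Subgroup.mem_top γ)⟩
    (IsQuasimodularForm.comp_doublePoint ⟨mF, G, mG, bG, hG⟩) ((2 : ℂ) ^ (w - (s : ℤ)))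

/-- Since `q (2 z) = q (z) ^ 2`, the coefficients of `X (2 z)` are those of `X` spread out over the
even exponents. -/
lemma hasSum_extremalY {w : ℤ} {s : ℕ} {X : ℍ → ℂ} {p : PowerSeries ℂ} (hX : HasQExpansion X p)
    (z : ℍ) : HasSum (fun n : ℕ => (p.coeff n - (2 : ℂ) ^ (w - (s : ℤ)) *
      (if 2 ∣ n then p.coeff (n / 2) else 0)) * Function.Periodic.qParam 1 z ^ n)
      (extremalY w s X z) := by
  have hq : Function.Periodic.qParam 1 (doublePoint z) = Function.Periodic.qParam 1 z ^ 2 := by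
    rw [Function.Periodic.qParam, Function.Periodic.qParam, ← Complex.exp_nat_mul]
    congr 1
    simp [doublePoint]
    ring
  have h1 : HasSum (fun n : ℕ => (if 2 ∣ n then p.coeff (n / 2) else 0) *
      Function.Periodic.qParam 1 z ^ n) (X (doublePoint z)) := by
    have hinj : Function.Injective fun n : ℕ => 2 * n := mul_right_injective₀ two_ne_zero
    rw [← hinj.hasSum_iff]
    · convert! hX.hasSum (doublePoint z) using 2 with n
      simp [hq, pow_mul]
    · intro n hn
      have : ¬ 2 ∣ n := fun ⟨m, hm⟩ => hn ⟨m, hm.symm⟩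
      simp [this]
  have := (hX.hasSum z).sub (h1.mul_left ((2 : ℂ) ^ (w - (s : ℤ))))
  convert! this using 2 with n
  ring

/-! ### Level one modular forms of small weight -/

lemma ModularForm.exists_eq_smul {k l : ℤ} (hkl : k = l) (hk : k < 12)
    {g : ModularForm 𝒮ℒ l} {r : PowerSeries ℂ} (hg : HasQExpansion g r) (hr : r.coeff 0 = 1)
    (f : ModularForm 𝒮ℒ k) : ∃ c : ℂ, (f : ℍ → ℂ) = c • (g : ℍ → ℂ) :=
  ⟨_, ModularForm.eq_smul_of_weight_lt_twelve hkl hk hg hr f.hasQExpansion⟩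

lemma ModularForm.eq_zero_of_weight_two {k : ℤ} (hk : k = 2) (f : ModularForm 𝒮ℒ k) :
    (f : ℍ → ℂ) = 0 := by
  subst hk
  rw [rank_zero_iff_forall_zero.mp levelOne_weight_two_rank_zero f]
  rfl

lemma hasQExpansion_one : HasQExpansion (1 : ModularForm 𝒮ℒ 0) 1 where
  mdiff := ModularFormClass.holo _
  hasSum z := by
    rw [ModularForm.one_coe_eq_one]
    have h : (fun n : ℕ => (1 : PowerSeries ℂ).coeff n * Function.Periodic.qParam 1 z ^ n) =
        fun n => if n = 0 then 1 else 0 := by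
      ext n
      rcases n with _ | n <;> simp [PowerSeries.coeff_one]
    rw [h]
    exact hasSum_ite_eq 0 1

lemma ModularForm.exists_eq_smul_one {k : ℤ} (hk : k = 0) (f : ModularForm 𝒮ℒ k) :
    ∃ c : ℂ, (f : ℍ → ℂ) = c • (1 : ℍ → ℂ) := by
  rw [← ModularForm.one_coe_eq_one (Γ := 𝒮ℒ)]
  exact ModularForm.exists_eq_smul hk (by omega) hasQExpansion_one (by simp) f

lemma ModularForm.exists_eq_smul_E₄ {k : ℤ} (hk : k = 4) (f : ModularForm 𝒮ℒ k) :
    ∃ c : ℂ, (f : ℍ → ℂ) = c • (E₄ : ℍ → ℂ) :=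
  ModularForm.exists_eq_smul hk (by omega) hasQExpansion_E₄ (by simp) f

lemma ModularForm.exists_eq_smul_E₆ {k : ℤ} (hk : k = 6) (f : ModularForm 𝒮ℒ k) :
    ∃ c : ℂ, (f : ℍ → ℂ) = c • (E₆ : ℍ → ℂ) :=
  ModularForm.exists_eq_smul hk (by omega) hasQExpansion_E₆ (by simp) f

lemma ModularForm.exists_eq_smul_E₄_sq {k : ℤ} (hk : k = 8) (f : ModularForm 𝒮ℒ k) :
    ∃ c : ℂ, (f : ℍ → ℂ) = c • ((E₄ : ℍ → ℂ) * E₄) := by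
  rw [← ModularForm.coe_mul]
  exact ModularForm.exists_eq_smul hk (by omega) hasQExpansion_E₄_sq (by simp) f

lemma ModularForm.exists_eq_smul_E₄_mul_E₆ {k : ℤ} (hk : k = 10) (f : ModularForm 𝒮ℒ k) :
    ∃ c : ℂ, (f : ℍ → ℂ) = c • ((E₄ : ℍ → ℂ) * E₆) := by
  rw [← ModularForm.coe_mul]
  exact ModularForm.exists_eq_smul hk (by omega) hasQExpansion_E₄_mul_E₆ (by simp) f

/-- The modular form `a E₄³ + b E₆²`. -/
noncomputable def weightTwelveForm (a b : ℂ) : ModularForm 𝒮ℒ 12 :=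
  ModularForm.mcast (a := 4 + (4 + 4)) (by norm_num) (a • E₄.mul (E₄.mul E₄)) +
    ModularForm.mcast (a := 6 + 6) (by norm_num) (b • E₆.mul E₆)

lemma coe_weightTwelveForm (a b : ℂ) : (weightTwelveForm a b : ℍ → ℂ) =
    a • ((E₄ : ℍ → ℂ) * (E₄ * E₄)) + b • ((E₆ : ℍ → ℂ) * E₆) := rfl

section Coefficients

variable (c : ℂ) (k : ℕ)

lemma coeff_zero_eisensteinQSeries : (eisensteinQSeries c k).coeff 0 = 1 := by simp

lemma coeff_one_eisensteinQSeries : (eisensteinQSeries c k).coeff 1 = c := by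
  simp [coeff_eisensteinQSeries]

lemma coeff_two_eisensteinQSeries : (eisensteinQSeries c k).coeff 2 = c * (1 + 2 ^ k) := by
  simp [coeff_eisensteinQSeries, ArithmeticFunction.sigma_apply,
    show Nat.divisors 2 = {1, 2} by decide]

lemma coeff_three_eisensteinQSeries : (eisensteinQSeries c k).coeff 3 = c * (1 + 3 ^ k) := by
  simp [coeff_eisensteinQSeries, ArithmeticFunction.sigma_apply,
    show Nat.divisors 3 = {1, 3} by decide]

end Coefficients

lemma PowerSeries.coeff_zero_mul' (p r : PowerSeries ℂ) :
    (p * r).coeff 0 = p.coeff 0 * r.coeff 0 := by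
  simp

lemma PowerSeries.coeff_one_mul' (p r : PowerSeries ℂ) :
    (p * r).coeff 1 = p.coeff 0 * r.coeff 1 + p.coeff 1 * r.coeff 0 := by
  simp [PowerSeries.coeff_mul, Finset.Nat.antidiagonal_succ]

lemma PowerSeries.coeff_two_mul (p r : PowerSeries ℂ) :
    (p * r).coeff 2 = p.coeff 0 * r.coeff 2 + p.coeff 1 * r.coeff 1 + p.coeff 2 * r.coeff 0 := by
  simp [PowerSeries.coeff_mul, Finset.Nat.antidiagonal_succ, add_assoc]

lemma PowerSeries.coeff_three_mul (p r : PowerSeries ℂ) :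
    (p * r).coeff 3 = p.coeff 0 * r.coeff 3 + p.coeff 1 * r.coeff 2 + p.coeff 2 * r.coeff 1 +
      p.coeff 3 * r.coeff 0 := by
  simp [PowerSeries.coeff_mul, Finset.Nat.antidiagonal_succ, add_assoc]

lemma ModularForm.exists_eq_of_weight_twelve {k : ℤ} (hk : k = 12) (f : ModularForm 𝒮ℒ k) :
    ∃ a b : ℂ, (f : ℍ → ℂ) = a • ((E₄ : ℍ → ℂ) * (E₄ * E₄)) + b • ((E₆ : ℍ → ℂ) * E₆) := by
  subst hk
  have hq := f.hasQExpansion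
  set p := qExpansion 1 f
  -- the coefficients match the first two Fourier coefficients of `f`
  let a : ℂ := (1008 * p.coeff 0 + p.coeff 1) / 1728
  let b : ℂ := (720 * p.coeff 0 - p.coeff 1) / 1728
  refine ⟨a, b, ?_⟩
  have h := hq.sub (((hasQExpansion_E₄.mul hasQExpansion_E₄_sq).smul a).add
    ((hasQExpansion_E₆.mul hasQExpansion_E₆).smul b))
  rw [← coe_weightTwelveForm] at h ⊢
  have h0 : f - weightTwelveForm a b = 0 := by
    apply sturm_bound_levelOne
    have hq : qExpansion 1 (f - weightTwelveForm a b : ModularForm 𝒮ℒ 12) = _ := h.qExpansion_eq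
    rw [hq, show (12 : ℤ).toNat / 12 = 1 from rfl, Nat.cast_one]
    refine lt_of_lt_of_le (by norm_num) (PowerSeries.nat_le_order _ 2 fun i hi => ?_)
    interval_cases i
    · simp only [map_sub, map_add, PowerSeries.coeff_smul, PowerSeries.coeff_zero_mul',
        coeff_zero_eisensteinQSeries, smul_eq_mul, a, b]
      ring
    · simp only [map_sub, map_add, PowerSeries.coeff_smul, PowerSeries.coeff_one_mul',
        coeff_zero_eisensteinQSeries, coeff_one_eisensteinQSeries, smul_eq_mul,
        a, b]
      ring
  rw [sub_eq_zero] at h0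
  exact congrArg DFunLike.coe h0

/-! ### Normalized extremal forms -/

lemma IsQuasimodularForm.hasQExpansion {w : ℤ} {F : ℍ → ℂ} (hF : IsQuasimodularForm w 2 ⊤ F) :
    HasQExpansion F (qExpansion 1 F) := by
  obtain ⟨f₀, f₁, f₂, rfl⟩ := hF.exists_modularForm
  have h := (f₀.hasQExpansion.add (hasQExpansion_E2.mul f₁.hasQExpansion)).add
    ((hasQExpansion_E2.mul hasQExpansion_E2).mul f₂.hasQExpansion)
  rwa [h.qExpansion_eq]

/-- A criterion for extremality: `X = q ^ m + O(q ^ (m + 1))`, and vanishing to order `m` forces a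
quasimodular form to be a multiple of `X`. -/
theorem isNormalizedExtremal_and_unique {w : ℤ} {X : ℍ → ℂ} {x : PowerSeries ℂ} {m : ℕ}
    (hX : IsQuasimodularForm w 2 ⊤ X) (hx : HasQExpansion X x) (hlt : ∀ i < m, x.coeff i = 0)
    (hm : x.coeff m = 1)
    (hdim : ∀ F, IsQuasimodularForm w 2 ⊤ F → ∀ p, HasQExpansion F p → (∀ i < m, p.coeff i = 0) →
      F = p.coeff m • X) :
    IsNormalizedExtremal w 2 X ∧ ∀ X', IsNormalizedExtremal w 2 X' → X' = X := by
  have hord : x.order = m := by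
    refine PowerSeries.order_eq_nat.mpr ⟨by rw [hm]; exact one_ne_zero, hlt⟩
  have hle (F : ℍ → ℂ) (hF : IsQuasimodularForm w 2 ⊤ F) (h0 : F ≠ 0) :
      vanishingOrder F ≤ m := by
    by_contra! hlt'
    have hz (i : ℕ) (hi : i ≤ m) : (qExpansion 1 F).coeff i = 0 :=
      PowerSeries.coeff_of_lt_order _ (lt_of_le_of_lt (by exact_mod_cast hi) hlt')
    apply h0
    rw [hdim F hF _ hF.hasQExpansion fun i hi => hz i hi.le, hz m le_rfl, zero_smul]
  have hXm : vanishingOrder X = m := by rw [vanishingOrder, hx.qExpansion_eq, hord]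
  have hX0 : X ≠ 0 := by
    rintro rfl
    rw [← hx.qExpansion_eq, qExpansion_zero] at hm
    simp at hm
  refine ⟨⟨hX, hX0, fun G hG hG0 => hXm ▸ hle G hG hG0, ?_⟩, ?_⟩
  · rw [hXm, hx.qExpansion_eq, ENat.toNat_natCast, hm]
  · rintro X' ⟨hX', hX'0, hmax, hnorm⟩
    have hX'm : vanishingOrder X' = m := le_antisymm (hle X' hX' hX'0) (hXm ▸ hmax X hX hX0)
    rw [hX'm, ENat.toNat_natCast] at hnorm
    rw [hdim X' hX' _ hX'.hasQExpansion, hnorm, one_smul]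
    intro i hi
    refine PowerSeries.coeff_of_lt_order _ ?_
    change _ < vanishingOrder X'
    rw [hX'm]
    exact_mod_cast hi

/-- The extremal form `-D E2 / 24` of weight `4`. -/
noncomputable def extremalFour : ℍ → ℂ := (-24⁻¹ : ℂ) • normalizedDerivOfComplex E2

/-- The extremal form of weight `8`: the combination of `D E₆` and `D² E₄` without a
term in `q`, normalized to start with `q²`. -/
noncomputable def extremalEight : ℍ → ℂ :=
  (-15120⁻¹ : ℂ) • normalizedDerivOfComplex E₆ -
    (7200⁻¹ : ℂ) • normalizedDerivOfComplex (normalizedDerivOfComplex E₄)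

/-- The extremal form of weight `10`: the combination of `D (E₄²)` and `D² E₆` without a
term in `q`, normalized to start with `q²`. -/
noncomputable def extremalTen : ℍ → ℂ :=
  (60480⁻¹ : ℂ) • normalizedDerivOfComplex ((E₄ : ℍ → ℂ) * E₄) +
    (63504⁻¹ : ℂ) • normalizedDerivOfComplex (normalizedDerivOfComplex E₆)

/-- The extremal form of weight `12`: the combination of `D (E₄ E₆)`, `D² (E₄²)` and `(D E₄)²`
without terms in `q` and `q²`, normalized to start with `q³`. -/
noncomputable def extremalTwelve : ℍ → ℂ :=
  (378000⁻¹ : ℂ) • ((-(3 / 44) : ℂ) • normalizedDerivOfComplex ((E₄ : ℍ → ℂ) * E₆) -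
    (3 / 80 : ℂ) • normalizedDerivOfComplex (normalizedDerivOfComplex ((E₄ : ℍ → ℂ) * E₄)) -
    (51 / 320 : ℂ) • (normalizedDerivOfComplex E₄ * normalizedDerivOfComplex E₄))

lemma extremalFour_eq : extremalFour = (288⁻¹ : ℂ) • E₄ - (288⁻¹ : ℂ) • (E2 * E2) := by
  ext z
  simp [extremalFour, deriv_E2]
  ring

lemma deriv_E₄_sq : normalizedDerivOfComplex ((E₄ : ℍ → ℂ) * E₄) =
    (2 / 3 : ℂ) • (E2 * (E₄ * E₄) - E₄ * E₆) := by
  have m4 := hasQExpansion_E₄.mdiff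
  rw [normalizedDerivOfComplex_mul _ _ m4 m4, deriv_E₄]
  ext z
  simp
  ring

lemma deriv_E₄_mul_E₆ : normalizedDerivOfComplex ((E₄ : ℍ → ℂ) * E₆) =
    (5 / 6 : ℂ) • (E2 * (E₄ * E₆)) - (3⁻¹ : ℂ) • (E₆ * E₆) - (2⁻¹ : ℂ) • (E₄ * (E₄ * E₄)) := by
  rw [normalizedDerivOfComplex_mul _ _ hasQExpansion_E₄.mdiff hasQExpansion_E₆.mdiff, deriv_E₄,
    deriv_E₆]
  ext z
  simp
  ring

lemma deriv_deriv_E₄ : normalizedDerivOfComplex (normalizedDerivOfComplex E₄) =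
    (5 / 36 : ℂ) • (E2 * E2 * E₄ - (2 : ℂ) • (E2 * E₆) + E₄ * E₄) := by
  have m2 := E2_mdifferentiable
  have m4 := hasQExpansion_E₄.mdiff
  have m6 := hasQExpansion_E₆.mdiff
  rw [deriv_E₄, normalizedDerivOfComplex_smul _ _ ((m2.mul m4).sub m6),
    normalizedDerivOfComplex_sub _ _ (m2.mul m4) m6, normalizedDerivOfComplex_mul _ _ m2 m4,
    deriv_E2, deriv_E₄, deriv_E₆]
  ext z
  simp
  ring

lemma deriv_deriv_E₆ : normalizedDerivOfComplex (normalizedDerivOfComplex E₆) =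
    (7 / 24 : ℂ) • (E2 * E2 * E₆ - (2 : ℂ) • (E2 * (E₄ * E₄)) + E₄ * E₆) := by
  have m2 := E2_mdifferentiable
  have m4 := hasQExpansion_E₄.mdiff
  have m6 := hasQExpansion_E₆.mdiff
  rw [deriv_E₆, normalizedDerivOfComplex_smul _ _ ((m2.mul m6).sub (m4.mul m4)),
    normalizedDerivOfComplex_sub _ _ (m2.mul m6) (m4.mul m4),
    normalizedDerivOfComplex_mul _ _ m2 m6, deriv_E2, deriv_E₄_sq, deriv_E₆]
  ext z
  simp
  ring

lemma deriv_deriv_E₄_sq :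
    normalizedDerivOfComplex (normalizedDerivOfComplex ((E₄ : ℍ → ℂ) * E₄)) =
    (2⁻¹ : ℂ) • (E2 * E2 * (E₄ * E₄)) - E2 * (E₄ * E₆) + (2 / 9 : ℂ) • (E₆ * E₆) +
      (5 / 18 : ℂ) • (E₄ * (E₄ * E₄)) := by
  have m2 := E2_mdifferentiable
  have m4 := hasQExpansion_E₄.mdiff
  have m6 := hasQExpansion_E₆.mdiff
  rw [deriv_E₄_sq, normalizedDerivOfComplex_smul _ _ ((m2.mul (m4.mul m4)).sub (m4.mul m6)),
    normalizedDerivOfComplex_sub _ _ (m2.mul (m4.mul m4)) (m4.mul m6),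
    normalizedDerivOfComplex_mul _ _ m2 (m4.mul m4), deriv_E2, deriv_E₄_sq, deriv_E₄_mul_E₆]
  ext z
  simp
  ring

lemma extremalEight_eq : extremalEight = (72576⁻¹ : ℂ) • (E₄ * E₄) +
    (181440⁻¹ : ℂ) • (E2 * E₆) - (51840⁻¹ : ℂ) • (E2 * E2 * E₄) := by
  rw [extremalEight, deriv_E₆, deriv_deriv_E₄]
  ext z
  simp
  ring

lemma extremalTen_eq : extremalTen = (-155520⁻¹ : ℂ) • (E₄ * E₆) +
    (544320⁻¹ : ℂ) • (E2 * (E₄ * E₄)) + (217728⁻¹ : ℂ) • (E2 * E2 * E₆) := by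
  rw [extremalTen, deriv_E₄_sq, deriv_deriv_E₆]
  ext z
  simp
  ring

lemma extremalTwelve_eq : extremalTwelve = (15966720⁻¹ : ℂ) • (E₄ * (E₄ * E₄)) -
    (114048000⁻¹ : ℂ) • (E₆ * E₆) + (17 / 399168000 : ℂ) • (E2 * (E₄ * E₆)) -
    (10368000⁻¹ : ℂ) • (E2 * E2 * (E₄ * E₄)) := by
  rw [extremalTwelve, deriv_E₄_mul_E₆, deriv_deriv_E₄_sq, deriv_E₄]
  ext z
  simp
  ring

/-! ### Vanishing order and uniqueness -/

/-- In the linear combination, here and in the other weights, the multiplier of the hypothesis on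
the coefficient of `q ^ i` is the quasimodular form of the shape `q ^ i + O(q ^ (m + 1))`, where `m`
is the extremal vanishing order. -/
lemma IsQuasimodularForm.eq_smul_extremalFour {F : ℍ → ℂ} (hF : IsQuasimodularForm 4 2 ⊤ F)
    {p : PowerSeries ℂ} (hp : HasQExpansion F p) (h0 : ∀ i < 1, p.coeff i = 0) :
    F = p.coeff 1 • extremalFour := by
  obtain ⟨f₀, f₁, f₂, hFf⟩ := hF.exists_modularForm
  obtain ⟨a, ha⟩ := f₀.exists_eq_smul_E₄ rfl
  obtain ⟨b, hb⟩ := f₂.exists_eq_smul_one rfl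
  have hf : F = a • (E₄ : ℍ → ℂ) + b • (E2 * E2) := by
    rw [hFf, ha, hb, f₁.eq_zero_of_weight_two rfl]
    ext z
    simp
  have hq := (hasQExpansion_E₄.smul a).add ((hasQExpansion_E2.mul hasQExpansion_E2).smul b)
  rw [← hf] at hq
  obtain rfl := hp.qExpansion_eq.symm.trans hq.qExpansion_eq
  have e0 := h0 0 (by norm_num)
  simp only [map_add, PowerSeries.coeff_smul, PowerSeries.coeff_zero_mul', smul_eq_mul,
    PowerSeries.coeff_one_mul', coeff_zero_eisensteinQSeries, coeff_one_eisensteinQSeries] at e0 ⊢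
  rw [hf, extremalFour_eq]
  ext z
  simp only [Pi.add_apply, Pi.sub_apply, Pi.smul_apply, Pi.mul_apply, smul_eq_mul]
  linear_combination (6⁻¹ * E₄ z + 5 / 6 * (E2 z * E2 z)) * e0

lemma IsQuasimodularForm.eq_smul_extremalEight {F : ℍ → ℂ} (hF : IsQuasimodularForm 8 2 ⊤ F)
    {p : PowerSeries ℂ} (hp : HasQExpansion F p) (h0 : ∀ i < 2, p.coeff i = 0) :
    F = p.coeff 2 • extremalEight := by
  obtain ⟨f₀, f₁, f₂, hFf⟩ := hF.exists_modularForm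
  obtain ⟨a, ha⟩ := f₀.exists_eq_smul_E₄_sq rfl
  obtain ⟨b, hb⟩ := f₁.exists_eq_smul_E₆ rfl
  obtain ⟨c, hc⟩ := f₂.exists_eq_smul_E₄ rfl
  have hf : F = a • ((E₄ : ℍ → ℂ) * E₄) + b • (E2 * E₆) + c • (E2 * E2 * E₄) := by
    rw [hFf, ha, hb, hc]
    ext z
    simp
  have hq := ((hasQExpansion_E₄_sq.smul a).add
    ((hasQExpansion_E2.mul hasQExpansion_E₆).smul b)).add
    (((hasQExpansion_E2.mul hasQExpansion_E2).mul hasQExpansion_E₄).smul c)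
  rw [← hf] at hq
  obtain rfl := hp.qExpansion_eq.symm.trans hq.qExpansion_eq
  have e0 := h0 0 (by norm_num)
  have e1 := h0 1 (by norm_num)
  simp only [map_add, PowerSeries.coeff_smul, PowerSeries.coeff_zero_mul', smul_eq_mul,
    PowerSeries.coeff_one_mul', PowerSeries.coeff_two_mul, coeff_zero_eisensteinQSeries,
    coeff_one_eisensteinQSeries, coeff_two_eisensteinQSeries] at e0 e1 ⊢
  rw [hf, extremalEight_eq]
  ext z
  simp only [Pi.add_apply, Pi.sub_apply, Pi.smul_apply, Pi.mul_apply, smul_eq_mul]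
  linear_combination (3 / 28 * (E₄ z * E₄ z) + 13 / 42 * (E2 z * E₆ z) +
    7 / 12 * (E2 z * E2 z * E₄ z)) * e0 + (1 / 12096 * (E₄ z * E₄ z) -
    41 / 30240 * (E2 z * E₆ z) + 11 / 8640 * (E2 z * E2 z * E₄ z)) * e1

lemma IsQuasimodularForm.eq_smul_extremalTen {F : ℍ → ℂ} (hF : IsQuasimodularForm 10 2 ⊤ F)
    {p : PowerSeries ℂ} (hp : HasQExpansion F p) (h0 : ∀ i < 2, p.coeff i = 0) :
    F = p.coeff 2 • extremalTen := by
  obtain ⟨f₀, f₁, f₂, hFf⟩ := hF.exists_modularForm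
  obtain ⟨a, ha⟩ := f₀.exists_eq_smul_E₄_mul_E₆ rfl
  obtain ⟨b, hb⟩ := f₁.exists_eq_smul_E₄_sq rfl
  obtain ⟨c, hc⟩ := f₂.exists_eq_smul_E₆ rfl
  have hf : F = a • ((E₄ : ℍ → ℂ) * E₆) + b • (E2 * (E₄ * E₄)) + c • (E2 * E2 * E₆) := by
    rw [hFf, ha, hb, hc]
    ext z
    simp
  have hq := ((hasQExpansion_E₄_mul_E₆.smul a).add
    ((hasQExpansion_E2.mul hasQExpansion_E₄_sq).smul b)).add
    (((hasQExpansion_E2.mul hasQExpansion_E2).mul hasQExpansion_E₆).smul c)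
  rw [← hf] at hq
  obtain rfl := hp.qExpansion_eq.symm.trans hq.qExpansion_eq
  have e0 := h0 0 (by norm_num)
  have e1 := h0 1 (by norm_num)
  simp only [map_add, PowerSeries.coeff_smul, PowerSeries.coeff_zero_mul', smul_eq_mul,
    PowerSeries.coeff_one_mul', PowerSeries.coeff_two_mul, coeff_zero_eisensteinQSeries,
    coeff_one_eisensteinQSeries, coeff_two_eisensteinQSeries] at e0 e1 ⊢
  rw [hf, extremalTen_eq]
  ext z
  simp only [Pi.add_apply, Pi.smul_apply, Pi.mul_apply, smul_eq_mul]
  linear_combination (433 / 2160 * (E₄ z * E₆ z) + 3707 / 7560 * (E2 z * (E₄ z * E₄ z)) +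
    935 / 3024 * (E2 z * E2 z * E₆ z)) * e0 + (7 / 25920 * (E₄ z * E₆ z) +
    83 / 90720 * (E2 z * (E₄ z * E₄ z)) - 43 / 36288 * (E2 z * E2 z * E₆ z)) * e1

lemma IsQuasimodularForm.eq_smul_extremalTwelve {F : ℍ → ℂ} (hF : IsQuasimodularForm 12 2 ⊤ F)
    {p : PowerSeries ℂ} (hp : HasQExpansion F p) (h0 : ∀ i < 3, p.coeff i = 0) :
    F = p.coeff 3 • extremalTwelve := by
  obtain ⟨f₀, f₁, f₂, hFf⟩ := hF.exists_modularForm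
  obtain ⟨a, b, hab⟩ := f₀.exists_eq_of_weight_twelve rfl
  obtain ⟨c, hc⟩ := f₁.exists_eq_smul_E₄_mul_E₆ rfl
  obtain ⟨d, hd⟩ := f₂.exists_eq_smul_E₄_sq rfl
  have hf : F = a • ((E₄ : ℍ → ℂ) * (E₄ * E₄)) + b • ((E₆ : ℍ → ℂ) * E₆) +
      c • (E2 * (E₄ * E₆)) + d • (E2 * E2 * (E₄ * E₄)) := by
    rw [hFf, hab, hc, hd]
    ext z
    simp
  have hq := ((((hasQExpansion_E₄.mul hasQExpansion_E₄_sq).smul a).add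
    ((hasQExpansion_E₆.mul hasQExpansion_E₆).smul b)).add
    ((hasQExpansion_E2.mul hasQExpansion_E₄_mul_E₆).smul c)).add
    (((hasQExpansion_E2.mul hasQExpansion_E2).mul hasQExpansion_E₄_sq).smul d)
  rw [← hf] at hq
  obtain rfl := hp.qExpansion_eq.symm.trans hq.qExpansion_eq
  have e0 := h0 0 (by norm_num)
  have e1 := h0 1 (by norm_num)
  have e2 := h0 2 (by norm_num)
  simp only [map_add, PowerSeries.coeff_smul, PowerSeries.coeff_zero_mul', smul_eq_mul,
    PowerSeries.coeff_one_mul', PowerSeries.coeff_two_mul, PowerSeries.coeff_three_mul,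
    coeff_zero_eisensteinQSeries, coeff_one_eisensteinQSeries, coeff_two_eisensteinQSeries,
    coeff_three_eisensteinQSeries] at e0 e1 e2 ⊢
  rw [hf, extremalTwelve_eq]
  ext z
  simp only [Pi.add_apply, Pi.sub_apply, Pi.smul_apply, Pi.mul_apply, smul_eq_mul]
  generalize E₄ z * (E₄ z * E₄ z) = u₀
  generalize E₆ z * E₆ z = u₁
  generalize E2 z * (E₄ z * E₆ z) = u₂
  generalize E2 z * E2 z * (E₄ z * E₄ z) = u₃
  linear_combination
    (-19 / 792 * u₀ + 1213 / 9900 * u₁ + 3419 / 9900 * u₂ + 1001 / 1800 * u₃) * e0 +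
    (677 / 1330560 * u₀ - 4967 / 9504000 * u₁ - 4661 / 33264000 * u₂ + 133 / 864000 * u₃) * e1 +
    (-1 / 443520 * u₀ + 1 / 445500 * u₁ - 269 / 49896000 * u₂ + 7 / 1296000 * u₃) * e2

/-! ### The quasimodularity of the extremal forms -/

lemma isQuasimodularForm_of_coe_eq {w : ℤ} {F g₀ g₁ g₂ : ℍ → ℂ} (f₀ : ModularForm 𝒮ℒ w)
    (f₁ : ModularForm 𝒮ℒ (w - 2)) (f₂ : ModularForm 𝒮ℒ (w - 4)) (h₀ : f₀ = g₀) (h₁ : f₁ = g₁)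
    (h₂ : f₂ = g₂) (hF : F = g₀ + E2 * g₁ + E2 * E2 * g₂) : IsQuasimodularForm w 2 ⊤ F := by
  subst h₀ h₁ h₂ hF
  exact isQuasimodularForm_of_modularForm f₀ f₁ f₂ ⊤

lemma isQuasimodularForm_extremalFour : IsQuasimodularForm 4 2 ⊤ extremalFour := by
  refine isQuasimodularForm_of_coe_eq (g₀ := (288⁻¹ : ℂ) • (E₄ : ℍ → ℂ)) (g₁ := 0)
    (g₂ := (-288⁻¹ : ℂ) • (1 : ℍ → ℂ)) ((288⁻¹ : ℂ) • E₄) 0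
    ((-288⁻¹ : ℂ) • (1 : ModularForm 𝒮ℒ 0)) rfl rfl rfl ?_
  rw [extremalFour_eq]
  ext z
  simp
  ring

lemma isQuasimodularForm_extremalEight : IsQuasimodularForm 8 2 ⊤ extremalEight := by
  refine isQuasimodularForm_of_coe_eq (g₀ := (72576⁻¹ : ℂ) • ((E₄ : ℍ → ℂ) * E₄))
    (g₁ := (181440⁻¹ : ℂ) • (E₆ : ℍ → ℂ)) (g₂ := (-51840⁻¹ : ℂ) • (E₄ : ℍ → ℂ))
    ((72576⁻¹ : ℂ) • E₄.mul E₄) ((181440⁻¹ : ℂ) • E₆) ((-51840⁻¹ : ℂ) • E₄) rfl rfl rfl ?_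
  rw [extremalEight_eq]
  ext z
  simp
  ring

lemma isQuasimodularForm_extremalTen : IsQuasimodularForm 10 2 ⊤ extremalTen := by
  refine isQuasimodularForm_of_coe_eq (g₀ := (-155520⁻¹ : ℂ) • ((E₄ : ℍ → ℂ) * E₆))
    (g₁ := (544320⁻¹ : ℂ) • ((E₄ : ℍ → ℂ) * E₄)) (g₂ := (217728⁻¹ : ℂ) • (E₆ : ℍ → ℂ))
    ((-155520⁻¹ : ℂ) • E₄.mul E₆) ((544320⁻¹ : ℂ) • E₄.mul E₄) ((217728⁻¹ : ℂ) • E₆)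
    rfl rfl rfl ?_
  rw [extremalTen_eq]
  ext z
  simp

lemma isQuasimodularForm_extremalTwelve : IsQuasimodularForm 12 2 ⊤ extremalTwelve := by
  refine isQuasimodularForm_of_coe_eq (g₁ := (17 / 399168000 : ℂ) • ((E₄ : ℍ → ℂ) * E₆))
    (g₂ := (-10368000⁻¹ : ℂ) • ((E₄ : ℍ → ℂ) * E₄))
    (weightTwelveForm 15966720⁻¹ (-114048000⁻¹)) ((17 / 399168000 : ℂ) • E₄.mul E₆)
    ((-10368000⁻¹ : ℂ) • E₄.mul E₄) (coe_weightTwelveForm _ _) rfl rfl ?_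
  rw [extremalTwelve_eq]
  ext z
  simp
  ring

/-! ### Inequalities for divisor sums -/

/-- The divisor power sum `σₖ(n)` as a real number. -/
noncomputable def realSigma (k n : ℕ) : ℝ := (ArithmeticFunction.sigma k n : ℝ)

lemma realSigma_eq_sum (k n : ℕ) : realSigma k n = ∑ d ∈ n.divisors, (d : ℝ) ^ k := by
  simp [realSigma, ArithmeticFunction.sigma_apply]

lemma realSigma_nonneg (k n : ℕ) : 0 ≤ realSigma k n := by
  rw [realSigma]
  positivity

lemma pow_le_realSigma {k : ℕ} (hk : k ≠ 0) (n : ℕ) : (n : ℝ) ^ k ≤ realSigma k n := by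
  rcases eq_or_ne n 0 with rfl | hn
  · simp [realSigma, hk]
  · rw [realSigma_eq_sum]
    exact Finset.single_le_sum (f := fun d : ℕ => (d : ℝ) ^ k) (fun d _ => by positivity)
      (Nat.mem_divisors_self n hn)

/-- The even divisors of `2 N` are the doubles of the divisors of `N`. -/
lemma two_pow_mul_realSigma_le (k N : ℕ) : 2 ^ k * realSigma k N ≤ realSigma k (2 * N) := by
  rcases eq_or_ne N 0 with rfl | hN
  · simp [realSigma]
  have hinj : Function.Injective fun d : ℕ => 2 * d := mul_right_injective₀ two_ne_zero
  rw [realSigma_eq_sum, realSigma_eq_sum, Finset.mul_sum]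
  calc ∑ d ∈ N.divisors, (2 : ℝ) ^ k * (d : ℝ) ^ k
      = ∑ d ∈ N.divisors.image (fun e : ℕ => 2 * e), (d : ℝ) ^ k := by
        rw [Finset.sum_image fun a _ b _ h => hinj h]
        simp [mul_pow]
    _ ≤ _ := by
        refine Finset.sum_le_sum_of_subset_of_nonneg ?_ fun _ _ _ => by positivity
        intro d hd
        obtain ⟨e, he, rfl⟩ := Finset.mem_image.mp hd
        rw [Nat.mem_divisors] at he ⊢
        exact ⟨Nat.mul_dvd_mul_left 2 he.1, by positivity⟩

/-- The odd divisors of `2 N` divide `N`, the even ones are doubles of divisors of `N`. -/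
lemma realSigma_two_mul_le (k N : ℕ) : realSigma k (2 * N) ≤ (2 ^ k + 1) * realSigma k N := by
  rcases eq_or_ne N 0 with rfl | hN
  · simp [realSigma]
  have hinj : Function.Injective fun d : ℕ => 2 * d := mul_right_injective₀ two_ne_zero
  have himage : ∑ d ∈ N.divisors.image (fun e : ℕ => 2 * e), (d : ℝ) ^ k =
      2 ^ k * realSigma k N := by
    rw [Finset.sum_image fun a _ b _ h => hinj h, realSigma_eq_sum, Finset.mul_sum]
    simp [mul_pow]
  have hsub : (2 * N).divisors ⊆ N.divisors.image (fun e : ℕ => 2 * e) ∪ N.divisors := by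
    intro d hd
    have hd' := Nat.dvd_of_mem_divisors hd
    rw [Finset.mem_union, Finset.mem_image]
    rcases Nat.even_or_odd' d with ⟨e, rfl | rfl⟩
    · exact .inl ⟨e, Nat.mem_divisors.mpr ⟨Nat.dvd_of_mul_dvd_mul_left two_pos hd', hN⟩, rfl⟩
    · refine .inr (Nat.mem_divisors.mpr ⟨?_, hN⟩)
      exact (Nat.Coprime.dvd_mul_left (by simp)).mp hd'
  calc realSigma k (2 * N) = ∑ d ∈ (2 * N).divisors, (d : ℝ) ^ k := realSigma_eq_sum _ _
    _ ≤ ∑ d ∈ N.divisors.image (fun e : ℕ => 2 * e) ∪ N.divisors, (d : ℝ) ^ k :=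
        Finset.sum_le_sum_of_subset_of_nonneg hsub fun _ _ _ => by positivity
    _ ≤ ∑ d ∈ N.divisors.image (fun e : ℕ => 2 * e), (d : ℝ) ^ k +
          ∑ d ∈ N.divisors, (d : ℝ) ^ k := by
        rw [← Finset.sum_union_inter]
        exact le_add_of_nonneg_right (Finset.sum_nonneg fun _ _ => by positivity)
    _ = (2 ^ k + 1) * realSigma k N := by
        rw [himage, ← realSigma_eq_sum]
        ring

/-- Pairing `d` with `e = n / d`, the inequality follows from
`d ^ (k + 2) + e ^ (k + 2) - d e (d ^ k + e ^ k) = (d ^ (k + 1) - e ^ (k + 1)) (d - e) ≥ 0`. -/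
lemma mul_realSigma_le (k n : ℕ) : n * realSigma k n ≤ realSigma (k + 2) n := by
  have h1 (m : ℕ) : realSigma m n = ∑ x ∈ n.divisorsAntidiagonal, (x.1 : ℝ) ^ m := by
    rw [realSigma_eq_sum, Nat.sum_divisorsAntidiagonal (f := fun d _ => (d : ℝ) ^ m)]
  have h2 (m : ℕ) : realSigma m n = ∑ x ∈ n.divisorsAntidiagonal, (x.2 : ℝ) ^ m := by
    rw [realSigma_eq_sum, Nat.sum_divisorsAntidiagonal' (f := fun _ d => (d : ℝ) ^ m)]
  have h : 0 ≤ ∑ x ∈ n.divisorsAntidiagonal, (((x.1 : ℝ) ^ (k + 2) + (x.2 : ℝ) ^ (k + 2)) -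
      n * ((x.1 : ℝ) ^ k + (x.2 : ℝ) ^ k)) := by
    refine Finset.sum_nonneg fun x hx => ?_
    have hn : (n : ℝ) = x.1 * x.2 := by exact_mod_cast (Nat.mem_divisorsAntidiagonal.mp hx).1.symm
    have hfac : ((x.1 : ℝ) ^ (k + 2) + (x.2 : ℝ) ^ (k + 2)) - n * ((x.1 : ℝ) ^ k + (x.2 : ℝ) ^ k) =
        ((x.1 : ℝ) ^ (k + 1) - (x.2 : ℝ) ^ (k + 1)) * (x.1 - x.2) := by
      rw [hn]
      ring
    rw [hfac]
    rcases le_total (x.1 : ℝ) x.2 with hle | hle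
    · exact mul_nonneg_of_nonpos_of_nonpos
        (sub_nonpos.mpr (pow_le_pow_left₀ (by positivity) hle _)) (sub_nonpos.mpr hle)
    · exact mul_nonneg (sub_nonneg.mpr (pow_le_pow_left₀ (by positivity) hle _))
        (sub_nonneg.mpr hle)
  rw [Finset.sum_sub_distrib, ← Finset.mul_sum, Finset.sum_add_distrib, Finset.sum_add_distrib,
    ← h1, ← h2, ← h1, ← h2] at h
  linarith

/-- The constant `33 / 32` exceeds `ζ(7)`. -/
lemma realSigma_seven_le (n : ℕ) : realSigma 7 n ≤ 33 / 32 * (n : ℝ) ^ 7 := by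
  rcases Nat.eq_zero_or_pos n with rfl | hn
  · simp [realSigma]
  -- a telescoping bound for the partial sums of `ζ(7)`
  have hzeta (m : ℕ) (hm : 1 ≤ m) :
      ∑ e ∈ (Finset.Icc 1 m : Finset ℕ), ((e : ℝ) ^ 7)⁻¹ ≤ 33 / 32 - 1 / (32 * m) := by
    induction m, hm using Nat.le_induction with
    | base => norm_num
    | succ m hm ih =>
      rw [Finset.sum_Icc_succ_top (by omega)]
      have hm' : (1 : ℝ) ≤ m := by exact_mod_cast hm
      have h32 : (32 : ℝ) * m * (m + 1) ≤ (m + 1) ^ 7 := by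
        have : (2 : ℝ) ^ 5 ≤ (m + 1) ^ 5 := pow_le_pow_left₀ (by norm_num) (by linarith) 5
        calc (32 : ℝ) * m * (m + 1) ≤ (m + 1) ^ 5 * ((m + 1) * (m + 1)) := by nlinarith
          _ = _ := by ring
      have hstep : (((m + 1 : ℕ) : ℝ) ^ 7)⁻¹ ≤ 1 / (32 * m) - 1 / (32 * ((m + 1 : ℕ) : ℝ)) := by
        push_cast
        calc (((m : ℝ) + 1) ^ 7)⁻¹ ≤ (32 * (m : ℝ) * (m + 1))⁻¹ := by
              apply inv_anti₀ (by positivity) h32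
          _ = _ := by field_simp; ring
      linarith
  have hn' : (0 : ℝ) < n := by exact_mod_cast hn
  calc realSigma 7 n = ∑ e ∈ n.divisors, ((n / e : ℕ) : ℝ) ^ 7 := by
        rw [realSigma_eq_sum, Nat.sum_div_divisors n fun d => (d : ℝ) ^ 7]
    _ = ∑ e ∈ n.divisors, (n : ℝ) ^ 7 * ((e : ℝ) ^ 7)⁻¹ := by
        refine Finset.sum_congr rfl fun e he => ?_
        have he0 : (e : ℝ) ≠ 0 := by exact_mod_cast (Nat.pos_of_mem_divisors he).ne'
        rw [Nat.cast_div (Nat.dvd_of_mem_divisors he) he0, div_pow, div_eq_mul_inv]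
    _ = (n : ℝ) ^ 7 * ∑ e ∈ n.divisors, ((e : ℝ) ^ 7)⁻¹ := by rw [Finset.mul_sum]
    _ ≤ (n : ℝ) ^ 7 * ∑ e ∈ (Finset.Icc 1 n : Finset ℕ), ((e : ℝ) ^ 7)⁻¹ := by
        gcongr
        intro e he
        exact Finset.mem_Icc.mpr ⟨Nat.pos_of_mem_divisors he, Nat.divisor_le he⟩
    _ ≤ (n : ℝ) ^ 7 * (33 / 32) := by
        gcongr
        have : 0 ≤ 1 / (32 * (n : ℝ)) := by positivity
        linarith [hzeta n hn]
    _ = _ := by ring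

/-- The convolution identity expressing `E₄ ^ 2 = E₈` in terms of coefficients. -/
lemma sum_antidiagonal_realSigma_three (n : ℕ) :
    ∑ x ∈ Finset.HasAntidiagonal.antidiagonal n, realSigma 3 x.1 * realSigma 3 x.2 =
      (realSigma 7 n - realSigma 3 n) / 120 := by
  have h := (hasQExpansion_E₄.mul hasQExpansion_E₄).qExpansion_eq.symm.trans
    hasQExpansion_E₄_sq.qExpansion_eq
  have hE (c : ℂ) (k : ℕ) : eisensteinQSeries c k =
      1 + PowerSeries.C c * .mk fun n => ((realSigma k n : ℝ) : ℂ) := by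
    ext n
    rcases n with _ | n <;> simp [coeff_eisensteinQSeries, realSigma, PowerSeries.coeff_one]
  set S : ℕ → PowerSeries ℂ := fun k => .mk fun n => ((realSigma k n : ℝ) : ℂ)
  have h240 : (PowerSeries.C (480 : ℂ)) = 2 * PowerSeries.C (240 : ℂ) := by
    rw [two_mul, ← map_add]
    norm_num
  have hsq : PowerSeries.C (240 : ℂ) * (PowerSeries.C (240 : ℂ) * (S 3 * S 3)) =
      PowerSeries.C (480 : ℂ) * S 7 - PowerSeries.C (480 : ℂ) * S 3 := by
    rw [hE, hE] at h
    linear_combination h + S 3 * h240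
  have hn := congrArg (PowerSeries.coeff n) hsq
  simp only [map_sub, PowerSeries.coeff_C_mul] at hn
  simp only [PowerSeries.coeff_mul, S, PowerSeries.coeff_mk] at hn
  have hn' : (240 : ℝ) * (240 * ∑ x ∈ Finset.HasAntidiagonal.antidiagonal n,
      realSigma 3 x.1 * realSigma 3 x.2) = 480 * realSigma 7 n - 480 * realSigma 3 n := by
    exact_mod_cast hn
  linarith

/-- The Fourier coefficients of `Δ`, from the identity `Δ = D² E₈ / 480 - (3 / 320) (D E₄)²`. -/
noncomputable def tauCoeff (n : ℕ) : ℝ :=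
  n ^ 2 * realSigma 7 n -
    540 * ∑ x ∈ Finset.HasAntidiagonal.antidiagonal n,
      (x.1 * realSigma 3 x.1) * (x.2 * realSigma 3 x.2)

/-- The sum in `tauCoeff` is bounded by means of `i j ≤ n ^ 2 / 4` and the convolution identity. -/
lemma neg_le_tauCoeff (n : ℕ) : -(n ^ 2 * realSigma 7 n / 8) ≤ tauCoeff n := by
  have h : ∑ x ∈ Finset.HasAntidiagonal.antidiagonal n,
      ((x.1 : ℝ) * realSigma 3 x.1) * (x.2 * realSigma 3 x.2) ≤
      ∑ x ∈ Finset.HasAntidiagonal.antidiagonal n,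
        (n : ℝ) ^ 2 / 4 * (realSigma 3 x.1 * realSigma 3 x.2) := by
    refine Finset.sum_le_sum fun x hx => ?_
    have hn : (n : ℝ) = x.1 + x.2 := by
      exact_mod_cast (Finset.HasAntidiagonal.mem_antidiagonal.mp hx).symm
    have h0 := mul_nonneg (realSigma_nonneg 3 x.1) (realSigma_nonneg 3 x.2)
    have h1 : (x.1 : ℝ) * x.2 ≤ n ^ 2 / 4 := by
      rw [hn]
      nlinarith [sq_nonneg ((x.1 : ℝ) - x.2)]
    calc _ = (x.1 : ℝ) * x.2 * (realSigma 3 x.1 * realSigma 3 x.2) := by ring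
      _ ≤ _ := mul_le_mul_of_nonneg_right h1 h0
  rw [← Finset.mul_sum, sum_antidiagonal_realSigma_three] at h
  have h3 := mul_nonneg (sq_nonneg (n : ℝ)) (realSigma_nonneg 3 n)
  rw [tauCoeff]
  linarith

lemma sum_range_succ_mul_sub (m : ℕ) (t : ℝ) :
    ∑ i ∈ Finset.range m, ((i : ℝ) + 1) * (t - i) =
      t * (m * (m + 1) / 2) - (m - 1) * m * (m + 1) / 3 := by
  induction m with
  | zero => simp
  | succ m ih =>
    rw [Finset.sum_range_succ, ih]
    push_cast
    ring

/-- Since `σ₃(i) ≥ i ^ 3`, the sum is at least `∑ (i j) ^ 4`, which is bounded below by the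
inequality between the fourth power mean and the arithmetic mean of the numbers `i j`. -/
lemma tauCoeff_succ_le (m : ℕ) : tauCoeff (m + 1) ≤ (m + 1) ^ 2 * realSigma 7 (m + 1) -
    540 * (m * ((m + 1) * (m + 2) / 6) ^ 4) := by
  rw [tauCoeff]
  push_cast
  gcongr
  -- `a` is the arithmetic mean of the products `i j` with `i, j ≥ 1`
  set a : ℝ := (m + 1) * (m + 2) / 6 with ha
  have hx (i : ℕ) (hi : i < m) : 4 * a ^ 3 * ((i + 1) * (m - i)) - 3 * a ^ 4 ≤
      (((i + 1 : ℕ) : ℝ) * realSigma 3 (i + 1)) * (((m - i : ℕ) : ℝ) * realSigma 3 (m - i)) := by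
    have h1 := pow_le_realSigma (k := 3) (by norm_num) (i + 1)
    have h2 := pow_le_realSigma (k := 3) (by norm_num) (m - i)
    have hc : ((m - i : ℕ) : ℝ) = m - i := Nat.cast_sub hi.le
    set x : ℝ := (i + 1) * (m - i)
    -- the tangent line of `x ^ 4` at `a`
    have h3 : 4 * a ^ 3 * x - 3 * a ^ 4 ≤ x ^ 4 := by
      have : 0 ≤ (x - a) ^ 2 * ((x + a) ^ 2 + 2 * a ^ 2) := by positivity
      nlinarith
    have h4 : x ^ 4 = (((i + 1 : ℕ) : ℝ) * ((i + 1 : ℕ) : ℝ) ^ 3) *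
        (((m - i : ℕ) : ℝ) * ((m - i : ℕ) : ℝ) ^ 3) := by
      rw [hc]
      push_cast
      simp only [x]
      ring
    refine h3.trans (h4.le.trans ?_)
    have h0 := realSigma_nonneg 3 (i + 1)
    gcongr
  have hsum : ∑ i ∈ Finset.range m, (4 * a ^ 3 * (((i : ℝ) + 1) * (m - i)) - 3 * a ^ 4) =
      m * a ^ 4 := by
    rw [Finset.sum_sub_distrib, ← Finset.mul_sum, sum_range_succ_mul_sub]
    simp [ha]
    ring
  rw [← hsum, Finset.Nat.sum_antidiagonal_eq_sum_range_succ_mk, Finset.sum_range_succ,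
    Finset.sum_range_succ']
  simp only [Nat.sub_self, Nat.cast_zero, zero_mul, mul_zero, add_zero, Nat.sub_zero]
  refine Finset.sum_le_sum fun i hi => ?_
  have := hx i (Finset.mem_range.mp hi)
  rwa [Nat.add_sub_add_right]

/-! ### Fourier coefficients of the extremal forms -/

/-- The `n`-th Fourier coefficient of the extremal form of weight `4`. -/
noncomputable def coeffFour (n : ℕ) : ℝ := n * realSigma 1 n

/-- The `n`-th Fourier coefficient of the extremal form of weight `8`. -/
noncomputable def coeffEight (n : ℕ) : ℝ := (n * realSigma 5 n - n ^ 2 * realSigma 3 n) / 30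

/-- The `n`-th Fourier coefficient of the extremal form of weight `10`. -/
noncomputable def coeffTen (n : ℕ) : ℝ := (n * realSigma 7 n - n ^ 2 * realSigma 5 n) / 126

/-- The `n`-th Fourier coefficient of the extremal form of weight `12`. -/
noncomputable def coeffTwelve (n : ℕ) : ℝ :=
  (18 * n * realSigma 9 n - 35 * n ^ 2 * realSigma 7 n + 17 * tauCoeff n) / 378000

/-- The factor `n` removes the exceptional constant term. -/
lemma natCast_mul_coeff_eisensteinQSeries (c : ℂ) (k n : ℕ) :
    n * (eisensteinQSeries c k).coeff n = c * (n * (realSigma k n : ℝ)) := by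
  rcases n with _ | n
  · simp
  · simp [coeff_eisensteinQSeries, realSigma]
    ring

lemma hasQExpansion_extremalFour :
    HasQExpansion extremalFour (.mk fun n => (coeffFour n : ℂ)) := by
  have h : HasQExpansion extremalFour _ :=
    hasQExpansion_E2.deriv.smul (-24⁻¹ : ℂ)
  convert h using 1
  ext n
  simp only [PowerSeries.coeff_smul, PowerSeries.coeff_mk, natCast_mul_coeff_eisensteinQSeries,
    smul_eq_mul, coeffFour]
  push_cast
  ring

lemma hasQExpansion_extremalEight :
    HasQExpansion extremalEight (.mk fun n => (coeffEight n : ℂ)) := by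
  have h : HasQExpansion extremalEight _ :=
    (hasQExpansion_E₆.deriv.smul (-15120⁻¹ : ℂ)).sub
    (hasQExpansion_E₄.deriv.deriv.smul (7200⁻¹ : ℂ))
  convert h using 1
  ext n
  simp only [map_sub, PowerSeries.coeff_smul, PowerSeries.coeff_mk,
    natCast_mul_coeff_eisensteinQSeries, smul_eq_mul, coeffEight]
  push_cast
  ring

lemma hasQExpansion_extremalTen :
    HasQExpansion extremalTen (.mk fun n => (coeffTen n : ℂ)) := by
  have h : HasQExpansion extremalTen _ :=
    (hasQExpansion_E₄_sq.deriv.smul (60480⁻¹ : ℂ)).add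
    (hasQExpansion_E₆.deriv.deriv.smul (63504⁻¹ : ℂ))
  convert h using 1
  ext n
  simp only [map_add, PowerSeries.coeff_smul, PowerSeries.coeff_mk,
    natCast_mul_coeff_eisensteinQSeries, smul_eq_mul, coeffTen]
  push_cast
  ring

lemma hasQExpansion_extremalTwelve :
    HasQExpansion extremalTwelve (.mk fun n => (coeffTwelve n : ℂ)) := by
  have h : HasQExpansion extremalTwelve _ :=
    (((hasQExpansion_E₄_mul_E₆.deriv.smul (-(3 / 44) : ℂ)).sub
    (hasQExpansion_E₄_sq.deriv.deriv.smul (3 / 80 : ℂ))).sub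
    ((hasQExpansion_E₄.deriv.mul hasQExpansion_E₄.deriv).smul (51 / 320 : ℂ))).smul
    (378000⁻¹ : ℂ)
  convert h using 1
  ext n
  have hsq : ∑ x ∈ Finset.HasAntidiagonal.antidiagonal n,
      (240 * ((x.1 : ℂ) * (realSigma 3 x.1 : ℝ))) * (240 * (x.2 * (realSigma 3 x.2 : ℝ))) =
      57600 * ∑ x ∈ Finset.HasAntidiagonal.antidiagonal n,
        (x.1 * (realSigma 3 x.1 : ℝ)) * (x.2 * (realSigma 3 x.2 : ℝ)) := by
    push_cast
    rw [Finset.mul_sum]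
    exact Finset.sum_congr rfl fun x _ => by ring
  simp only [map_sub, PowerSeries.coeff_smul, PowerSeries.coeff_mul, PowerSeries.coeff_mk,
    natCast_mul_coeff_eisensteinQSeries, smul_eq_mul, coeffTwelve, tauCoeff, hsq]
  push_cast
  ring

lemma realSigma_one (k : ℕ) : realSigma k 1 = 1 := by simp [realSigma]

lemma realSigma_two (k : ℕ) : realSigma k 2 = 1 + 2 ^ k := by
  simp [realSigma_eq_sum, show Nat.divisors 2 = {1, 2} by decide]

lemma realSigma_three (k : ℕ) : realSigma k 3 = 1 + 3 ^ k := by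
  simp [realSigma_eq_sum, show Nat.divisors 3 = {1, 3} by decide]

lemma tauCoeff_zero : tauCoeff 0 = 0 := by simp [tauCoeff]

lemma tauCoeff_one : tauCoeff 1 = 1 := by
  simp [tauCoeff, Finset.Nat.antidiagonal_succ, realSigma_one]

lemma tauCoeff_two : tauCoeff 2 = -24 := by
  simp [tauCoeff, Finset.Nat.antidiagonal_succ, realSigma_one, realSigma_two]
  norm_num

lemma tauCoeff_three : tauCoeff 3 = 252 := by
  simp [tauCoeff, Finset.Nat.antidiagonal_succ, realSigma_one, realSigma_two, realSigma_three]
  norm_num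

/-! ### Positivity -/

lemma coeffFour_nonneg (n : ℕ) : 0 ≤ coeffFour n :=
  mul_nonneg n.cast_nonneg (realSigma_nonneg 1 n)

lemma coeffEight_nonneg (n : ℕ) : 0 ≤ coeffEight n := by
  have := mul_le_mul_of_nonneg_left (mul_realSigma_le 3 n) (n.cast_nonneg (α := ℝ))
  rw [coeffEight]
  linarith

lemma coeffTen_nonneg (n : ℕ) : 0 ≤ coeffTen n := by
  have := mul_le_mul_of_nonneg_left (mul_realSigma_le 5 n) (n.cast_nonneg (α := ℝ))
  rw [coeffTen]
  linarith

/-- For `n ≥ 3` the term in `σ₉(n) ≥ n ^ 9` dominates. -/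
lemma coeffTwelve_nonneg_of_odd {n : ℕ} (hn : Odd n) : 0 ≤ coeffTwelve n := by
  obtain ⟨m, rfl⟩ := hn
  rcases Nat.eq_zero_or_pos m with rfl | hm
  · norm_num [coeffTwelve, realSigma_one, tauCoeff_one]
  set n := 2 * m + 1
  have hn3 : (3 : ℝ) ≤ n := by exact_mod_cast (show 3 ≤ n by omega)
  have h9 := mul_le_mul_of_nonneg_left (pow_le_realSigma (k := 9) (by norm_num) n)
    (n.cast_nonneg (α := ℝ))
  have h7 := mul_le_mul_of_nonneg_left (realSigma_seven_le n) (sq_nonneg (n : ℝ))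
  have hτ := neg_le_tauCoeff n
  have hpow : (n : ℝ) ^ 9 * 3 ≤ n ^ 9 * n := by gcongr
  have h10 : (0 : ℝ) ≤ n ^ 9 := by positivity
  rw [coeffTwelve]
  linarith

lemma four_mul_coeffFour_le (N : ℕ) : 2 ^ 2 * coeffFour N ≤ coeffFour (2 * N) := by
  have := mul_le_mul_of_nonneg_left (two_pow_mul_realSigma_le 1 N) (N.cast_nonneg (α := ℝ))
  rw [coeffFour, coeffFour]
  push_cast
  linarith

/-- The terms in `σ₅(N)` cancel, and `4 (2 ^ 3 + 1) ≤ 2 ^ 6`. -/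
lemma two_pow_mul_coeffEight_le (N : ℕ) : 2 ^ 6 * coeffEight N ≤ coeffEight (2 * N) := by
  have h5 := mul_le_mul_of_nonneg_left (two_pow_mul_realSigma_le 5 N) (N.cast_nonneg (α := ℝ))
  have h3 := mul_le_mul_of_nonneg_left (realSigma_two_mul_le 3 N) (sq_nonneg (N : ℝ))
  have h0 := mul_nonneg (sq_nonneg (N : ℝ)) (realSigma_nonneg 3 N)
  rw [coeffEight, coeffEight]
  push_cast
  linarith

/-- The terms in `σ₇(N)` cancel, and `4 (2 ^ 5 + 1) ≤ 2 ^ 8`. -/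
lemma two_pow_mul_coeffTen_le (N : ℕ) : 2 ^ 8 * coeffTen N ≤ coeffTen (2 * N) := by
  have h7 := mul_le_mul_of_nonneg_left (two_pow_mul_realSigma_le 7 N) (N.cast_nonneg (α := ℝ))
  have h5 := mul_le_mul_of_nonneg_left (realSigma_two_mul_le 5 N) (sq_nonneg (N : ℝ))
  have h0 := mul_nonneg (sq_nonneg (N : ℝ)) (realSigma_nonneg 5 N)
  rw [coeffTen, coeffTen]
  push_cast
  linarith

/-- The bound `σ₉ (2 N) ≥ 2 ^ 9 σ₉ (N)` only cancels the leading terms, and the trivial bounds on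
`σ₇ (2 N)` and `τ (2 N)` leave a deficit proportional to `N ^ 2 σ₇ (N)`. The upper
bound for `τ (N)`, which is smaller than `N ^ 2 σ₇ (N)` by a fixed proportion, makes up for it. -/
lemma two_pow_mul_coeffTwelve_le (N : ℕ) : 2 ^ 10 * coeffTwelve N ≤ coeffTwelve (2 * N) := by
  rcases N with _ | _ | m
  · norm_num [coeffTwelve, tauCoeff_zero]
  · norm_num [coeffTwelve, realSigma_one, realSigma_two, tauCoeff_one, tauCoeff_two]
  have hτ := tauCoeff_succ_le (m + 1)
  have hcast : ((m + 1 : ℕ) : ℝ) + 1 = ((m + 1 + 1 : ℕ) : ℝ) := by push_cast; ring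
  have hcast' : ((m + 1 : ℕ) : ℝ) = ((m + 1 + 1 : ℕ) : ℝ) - 1 := by push_cast; ring
  have hcast'' : ((m + 1 : ℕ) : ℝ) + 2 = ((m + 1 + 1 : ℕ) : ℝ) + 1 := by push_cast; ring
  rw [hcast, hcast'', hcast'] at hτ
  set N := m + 1 + 1
  have hN : (2 : ℝ) ≤ N := by exact_mod_cast (show 2 ≤ N by omega)
  have h9 := mul_le_mul_of_nonneg_left (two_pow_mul_realSigma_le 9 N) (N.cast_nonneg (α := ℝ))
  have h7 := mul_le_mul_of_nonneg_left (realSigma_two_mul_le 7 N) (sq_nonneg (N : ℝ))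
  have h7' := mul_le_mul_of_nonneg_left (realSigma_seven_le N) (sq_nonneg (N : ℝ))
  have hτ2 := neg_le_tauCoeff (2 * N)
  have hmain : (N : ℝ) ^ 9 / 2592 ≤ (N - 1) * (N * (N + 1) / 6) ^ 4 := by
    calc (N : ℝ) ^ 9 / 2592 = N / 2 * (N * N / 6) ^ 4 := by ring
      _ ≤ _ := by
        gcongr <;> linarith
  have h0 : (0 : ℝ) ≤ N ^ 9 := by positivity
  rw [coeffTwelve, coeffTwelve]
  push_cast at hτ2 ⊢
  linarith

/-- The coefficient of `q ^ n` in `Y` is `a n` for odd `n`, and `a (2 k) - 2 ^ m a k` for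
`n = 2 k`. -/
theorem isCompletelyPositive_extremalY {m : ℕ} {X : ℍ → ℂ} {a : ℕ → ℝ}
    (hX : IsQuasimodularForm (m + 2) 2 ⊤ X) (hq : HasQExpansion X (.mk fun n => (a n : ℂ)))
    (hodd : ∀ n, Odd n → 0 ≤ a n) (heven : ∀ n, 2 ^ m * a n ≤ a (2 * n)) :
    IsCompletelyPositive (m + 2) 2 (CongruenceSubgroup.Gamma0 2) (extremalY (m + 2) 2 X) := by
  refine ⟨isQuasimodularForm_extremalY hX,
    fun n => a n - 2 ^ m * if 2 ∣ n then a (n / 2) else 0, fun n => ?_, fun z => ?_⟩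
  · rcases Nat.even_or_odd' n with ⟨k, rfl | rfl⟩
    · simpa using heven k
    · simpa using hodd _ (odd_two_mul_add_one k)
  · convert hasSum_extremalY (w := m + 2) (s := 2) hq z using 3 with n
    have : ((m : ℤ) + 2 - (2 : ℕ)) = (m : ℤ) := by push_cast; ring
    rw [this, zpow_natCast]
    simp only [PowerSeries.coeff_mk]
    split_ifs <;> push_cast <;> rfl

/-- A quasimodular form satisfying the criterion for extremality, with nonnegative real
coefficients as in `isCompletelyPositive_extremalY`, yields the claim in its weight. -/
theorem existsUnique_and_isCompletelyPositive {w m : ℕ} {X : ℍ → ℂ} {a : ℕ → ℝ}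
    (hX : IsQuasimodularForm (w + 2) 2 ⊤ X) (hq : HasQExpansion X (.mk fun n => (a n : ℂ)))
    (hlt : ∀ i < m, a i = 0) (hm : a m = 1)
    (hdim : ∀ F, IsQuasimodularForm (w + 2) 2 ⊤ F → ∀ p, HasQExpansion F p →
      (∀ i < m, p.coeff i = 0) → F = p.coeff m • X)
    (hodd : ∀ n, Odd n → 0 ≤ a n) (heven : ∀ n, 2 ^ w * a n ≤ a (2 * n)) :
    (∃! X : ℍ → ℂ, IsNormalizedExtremal (w + 2) 2 X) ∧
      ∀ X : ℍ → ℂ, IsNormalizedExtremal (w + 2) 2 X →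
        IsCompletelyPositive (w + 2) 2 (CongruenceSubgroup.Gamma0 2) (extremalY (w + 2) 2 X) := by
  obtain ⟨h1, h2⟩ := isNormalizedExtremal_and_unique hX hq (fun i hi => by simp [hlt i hi])
    (by simp [hm]) hdim
  refine ⟨⟨X, h1, h2⟩, fun X' hX' => ?_⟩
  rw [h2 X' hX']
  exact isCompletelyPositive_extremalY hX hq hodd heven

end

theorem mainTheorem10 :
    ∀ w ∈ ({4, 8, 10, 12} : Set ℤ),
      (∃! X : ℍ → ℂ, IsNormalizedExtremal w 2 X) ∧
      ∀ X : ℍ → ℂ, IsNormalizedExtremal w 2 X →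
        IsCompletelyPositive w 2 (CongruenceSubgroup.Gamma0 2) (extremalY w 2 X) := by
  rintro w (rfl | rfl | rfl | rfl)
  · refine existsUnique_and_isCompletelyPositive (w := 2) (m := 1)
      isQuasimodularForm_extremalFour hasQExpansion_extremalFour (fun i hi => ?_) ?_
      (fun F hF p hp h => hF.eq_smul_extremalFour hp h) (fun n _ => coeffFour_nonneg n)
      four_mul_coeffFour_le
    · interval_cases i
      simp [coeffFour]
    · simp [coeffFour, realSigma_one]
  · refine existsUnique_and_isCompletelyPositive (w := 6) (m := 2)
      isQuasimodularForm_extremalEight hasQExpansion_extremalEight (fun i hi => ?_) ?_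
      (fun F hF p hp h => hF.eq_smul_extremalEight hp h) (fun n _ => coeffEight_nonneg n)
      two_pow_mul_coeffEight_le
    · interval_cases i <;> norm_num [coeffEight, realSigma_one]
    · norm_num [coeffEight, realSigma_two]
  · refine existsUnique_and_isCompletelyPositive (w := 8) (m := 2)
      isQuasimodularForm_extremalTen hasQExpansion_extremalTen (fun i hi => ?_) ?_
      (fun F hF p hp h => hF.eq_smul_extremalTen hp h) (fun n _ => coeffTen_nonneg n)
      two_pow_mul_coeffTen_le
    · interval_cases i <;> norm_num [coeffTen, realSigma_one]
    · norm_num [coeffTen, realSigma_two]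
  · refine existsUnique_and_isCompletelyPositive (w := 10) (m := 3)
      isQuasimodularForm_extremalTwelve hasQExpansion_extremalTwelve (fun i hi => ?_) ?_
      (fun F hF p hp h => hF.eq_smul_extremalTwelve hp h) (fun n hn => coeffTwelve_nonneg_of_odd hn)
      two_pow_mul_coeffTwelve_le
    · interval_cases i <;>
        norm_num [coeffTwelve, realSigma_one, realSigma_two, tauCoeff_zero, tauCoeff_one,
          tauCoeff_two]
    · norm_num [coeffTwelve, realSigma_three, tauCoeff_three]
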